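/- Let $J=[0,+\infty)$, let $\mathbb{R}^n$ carry a norm $\|\cdot\|$ and let $\mathcal{L}(\mathbb{R}^n)$ be the space of real $n\times n$ matrices with the induced operator norm. Let $A\colon J\to\mathcal{L}(\mathbb{R}^n)$ be of locally bounded variation and suppose that $I-[A(t)-A(t^-)]$ is invertible for every $t>0$ and $I+[A(t^+)-A(t)]$ is invertible for every $t\ge 0$. A function $x\colon[s_0,+\infty)\to\mathbb{R}^n$, $s_0\ge 0$, is a solution of the homogeneous generalized linear differential equation (GLDE) $\frac{dx}{d\tau}=D[A(t)x]$ if $x(d)-x(c)=\int_c^d \mathrm{d}[A(s)]\,x(s)$ for all $s_0\le c\le d$. Here $\int_a^b \mathrm{d}[A(s)]f(s)$ is the Kurzweil--Stieltjes integral: it is the element $\mathcal I$ such that for every $\varepsilon>0$ there is a gauge $\delta\colon[a,b]\to(0,+\infty)$ with $\big\|\sum_{j}[A(\alpha_j)-A(\alpha_{j-1})]f(\tau_j)-\mathcal I\big\|<\varepsilon$ for every partition $a=\alpha_0<\dots<\alpha_\nu=b$ with tags $\tau_j\in[\alpha_{j-1},\alpha_j]\subset(\tau_j-\delta(\tau_j),\tau_j+\delta(\tau_j))$,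 and $\int_b^a=-\int_a^b$. Then there is exactly one function $U\colon J\times J\to\mathcal{L}(\mathbb{R}^n)$, the transition matrix of the GLDE, such that $U(t,s)=I+\int_s^t\mathrm{d}[A(r)]\,U(r,s)$ for all $t,s\in J$, and the following are equivalent. (i) The trivial solution is uniformly asymptotically stable, i.e. it is uniformly stable (for every $\varepsilon>0$ there is $\delta>0$ such that every solution $x$ on $[s_0,+\infty)$, $s_0\ge0$, with $\|x(s_0)\|<\delta$ satisfies $\|x(t)\|<\varepsilon$ for all $t\ge s_0$), and there is $\delta_0>0$ such that for every $\varepsilon>0$ there is $T\ge0$ such that every solution $x$ on $[s_0,+\infty)$, $s_0\ge0$, with $\|x(s_0)\|<\delta_0$ satisfies $\|x(t)\|<\varepsilon$ for all $t\ge s_0+T$. (ii) There are constants $\alpha,K>0$ such that $\|U(t,s)\|\le Ke^{-\alpha(t-s)}$ for all $t\ge s\ge 0$. (iii) The trivial solution is globally uniformly exponentially stable, i.e. there are constants $\alpha,K>0$ such that every solution $x$ on $[s_0,+\infty)$, $s_0\ge0$, with $x(s_0)\ne0$ satisfies $\|x(t)\|<K\|x(s_0)\|e^{-\alpha(t-s_0)}$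 for all $t\ge s_0$. -/

import Mathlib

/-- A tagged partition `a = pt 0 < pt 1 < ... < pt ν = b` of `[a, b]` with tags
`tag j ∈ [pt j, pt (j+1)]` for `j < ν`. (The values of `pt` beyond `ν`, and of `tag` from `ν` on,
play no role.) -/
structure KurzweilPartition (a b : ℝ) where
  ν : ℕ
  pt : ℕ → ℝ
  tag : ℕ → ℝ
  pt_zero : pt 0 = a
  pt_last : pt ν = b
  pt_lt : ∀ j < ν, pt j < pt (j + 1)
  tag_mem : ∀ j < ν, tag j ∈ Set.Icc (pt j) (pt (j + 1))

namespace KurzweilPartition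

/-- `δ`-fineness of a tagged partition. -/
def IsFine {a b : ℝ} (P : KurzweilPartition a b) (δ : ℝ → ℝ) : Prop :=
  ∀ j < P.ν, Set.Icc (P.pt j) (P.pt (j + 1)) ⊆
    Set.Ioo (P.tag j - δ (P.tag j)) (P.tag j + δ (P.tag j))

/-- The Riemann-type sum `∑ [G(τ_j, α_j) - G(τ_j, α_{j-1})]`. -/
def riemannSum {X : Type*} [AddCommGroup X] {a b : ℝ} (P : KurzweilPartition a b)
    (G : ℝ → ℝ → X) : X :=
  ∑ j ∈ Finset.range P.ν, (G (P.tag j) (P.pt (j + 1)) - G (P.tag j) (P.pt j))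

end KurzweilPartition

/-- For `a ≤ b`: `G` is Kurzweil integrable on `[a, b]` and its integral is `I`.
Only the values of `G` on `[a, b] × [a, b]` matter. For `a = b` this says `I = 0`. -/
def HasKurzweilIntegral {X : Type*} [NormedAddCommGroup X] (G : ℝ → ℝ → X) (a b : ℝ) (I : X) :
    Prop :=
  ∀ ε > 0, ∃ δ : ℝ → ℝ, (∀ t ∈ Set.Icc a b, 0 < δ t) ∧
    ∀ P : KurzweilPartition a b, P.IsFine δ → ‖P.riemannSum G - I‖ < ε

/-- The oriented Kurzweil integral `∫_a^b DG(τ, t)` exists and equals `I`, with the convention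
`∫_a^b = -∫_b^a` when `b < a`. -/
def HasOrientedKurzweilIntegral {X : Type*} [NormedAddCommGroup X] (G : ℝ → ℝ → X) (a b : ℝ)
    (I : X) : Prop :=
  (a ≤ b → HasKurzweilIntegral G a b I) ∧ (b < a → HasKurzweilIntegral G b a (-I))

/-- `x` is a solution on the interval `J` of the generalized ODE `dx/dτ = DF(x, t)`. -/
def IsGODESolution {E : Type*} [NormedAddCommGroup E] (F : E → ℝ → E) (J : Set ℝ) (x : ℝ → E) :
    Prop :=
  ∀ c d : ℝ, c ≤ d → Set.Icc c d ⊆ J →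
    HasKurzweilIntegral (fun τ t => F (x τ) t) c d (x d - x c)

section GLDE

variable {E : Type*} [NormedAddCommGroup E] [NormedSpace ℝ E]

/-- `x` is a solution on `J` of the homogeneous generalized linear differential equation
`dx/dτ = D[A(t)x]`. -/
def IsGLDESolution (A : ℝ → E →L[ℝ] E) (J : Set ℝ) (x : ℝ → E) : Prop :=
  IsGODESolution (fun y t => A t y) J x

/-- Condition (D): `I - Δ⁻A(t)` is invertible for all `t > 0` and `I + Δ⁺A(t)` is invertible for
all `t ≥ 0`, where `Δ⁻A(t) = A(t) - A(t⁻)` and `Δ⁺A(t) = A(t⁺) - A(t)`. -/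
def ConditionD (A : ℝ → E →L[ℝ] E) : Prop :=
  (∀ t : ℝ, 0 < t → IsUnit (1 - (A t - Function.leftLim A t))) ∧
  (∀ t : ℝ, 0 ≤ t → IsUnit (1 + (Function.rightLim A t - A t)))

/-- `U` is a transition matrix: `U(t,s) = I + ∫_s^t d[A(r)] U(r,s)` for all `t, s ≥ 0`
(only the values of `U` on `[0,∞) × [0,∞)` matter). -/
def IsTransitionMatrix (A : ℝ → E →L[ℝ] E) (U : ℝ → ℝ → E →L[ℝ] E) : Prop :=
  ∀ t s : ℝ, 0 ≤ t → 0 ≤ s →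
    HasOrientedKurzweilIntegral (fun τ r => A r * U τ s) s t (U t s - 1)

/-- Uniform stability of the trivial solution. -/
def UniformlyStable (A : ℝ → E →L[ℝ] E) : Prop :=
  ∀ ε > 0, ∃ δ > 0, ∀ s₀ : ℝ, 0 ≤ s₀ → ∀ x : ℝ → E, IsGLDESolution A (Set.Ici s₀) x →
    ‖x s₀‖ < δ → ∀ t, s₀ ≤ t → ‖x t‖ < ε

/-- Uniform asymptotic stability of the trivial solution. -/
def UniformlyAsymptoticallyStable (A : ℝ → E →L[ℝ] E) : Prop :=
  UniformlyStable A ∧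
  ∃ δ₀ > 0, ∀ ε > 0, ∃ T : ℝ, 0 ≤ T ∧ ∀ s₀ : ℝ, 0 ≤ s₀ →
    ∀ x : ℝ → E, IsGLDESolution A (Set.Ici s₀) x →
      ‖x s₀‖ < δ₀ → ∀ t, s₀ + T ≤ t → ‖x t‖ < ε

/-- Global uniform exponential stability of the trivial solution. The strict inequality is
required for nonzero initial values only (it cannot hold for the zero solution itself). -/
def GloballyUniformlyExponentiallyStable (A : ℝ → E →L[ℝ] E) : Prop :=
  ∃ α > 0, ∃ K > 0, ∀ s₀ : ℝ, 0 ≤ s₀ → ∀ x : ℝ → E, IsGLDESolution A (Set.Ici s₀) x →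
    x s₀ ≠ 0 → ∀ t, s₀ ≤ t → ‖x t‖ < K * ‖x s₀‖ * Real.exp (-α * (t - s₀))

end GLDE

/-! The Kurzweil equation is reduced to a Lebesgue integral equation by a change of time. With `W t`
the variation of `A` on `[0, t]` plus `t`, one has `A = B ∘ W` on `[0, ∞)` with `B` Lipschitz. If
`T` is the generalized inverse of `W`, then `d[A]x` becomes `B'(r) x(T r) dr`. A jump of `A` at `t`
is spread over an interval on which `T` equals `t`, so it contributes an explicit algebraic term.

Existence: between neighbouring points the equation is solved by a contraction away from the end
jumps (`exists_isSolution`). The jump at the left end acts on the known initial value; the one at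
the right end is implicit and needs `1 - Δ⁻A` to be invertible. Interval induction then reaches
every compact interval, and `HasKurzweilIntegral.of_primitive` turns the result into a Kurzweil
solution.

Uniqueness concerns arbitrary Kurzweil solutions, in both directions of time: a solution crosses
each jump by an invertible matrix, and near a point the remaining growth of `W` is so small that any
bound of a solution vanishing at one end can be halved (`IsGLDESolution.eq_zero_iff`). This yields
an invertible fundamental solution `Y`, the matrix `U(t,s) = Y(t) Y(s)⁻¹`, the cocycle law and the
formula `x(t) = U(t,s) x(s)`.

The stability part is then classical: uniform stability bounds `U`, attraction gives `‖U(s+T,s)‖ ≤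
1/2` for a fixed `T`, and the cocycle law iterates this to exponential decay. -/

open Set Filter Topology MeasureTheory
open scoped NNReal

/-! ### Interval induction, tagged partitions and Cousin's lemma. -/

/-- Induction over a compact interval: a transitive relation that holds on both sides of each
point holds between the endpoints. -/
theorem Icc_induction {a b : ℝ} (hab : a ≤ b) {R : ℝ → ℝ → Prop}
    (hrefl : ∀ t ∈ Icc a b, R t t)
    (htrans : ∀ u v w, a ≤ u → u ≤ v → v ≤ w → w ≤ b → R u v → R v w → R u w)
    (hleft : ∀ t ∈ Ioc a b, ∃ ε > 0, ∀ u ∈ Icc a b, u < t → t - ε < u → R u t)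
    (hright : ∀ t ∈ Ico a b, ∃ ε > 0, ∀ v ∈ Icc a b, t < v → v < t + ε → R t v) : R a b := by
  set S : Set ℝ := {t | t ∈ Icc a b ∧ R a t} with hS
  have ha : a ∈ S := ⟨left_mem_Icc.2 hab, hrefl a (left_mem_Icc.2 hab)⟩
  have hbdd : BddAbove S := ⟨b, fun t ht => ht.1.2⟩
  set c := sSup S with hc
  have hac : a ≤ c := le_csSup hbdd ha
  have hcb : c ≤ b := csSup_le ⟨a, ha⟩ fun t ht => ht.1.2
  have hcS : R a c := by
    rcases hac.eq_or_lt with h | h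
    · rw [← h]; exact ha.2
    obtain ⟨ε, hε, hl⟩ := hleft c ⟨h, hcb⟩
    obtain ⟨u, hu, huc⟩ := exists_lt_of_lt_csSup ⟨a, ha⟩ (show c - ε < c by linarith)
    have huc' : u ≤ c := le_csSup hbdd hu
    rcases huc'.eq_or_lt with h' | h'
    · rw [← h']; exact hu.2
    · exact htrans a u c le_rfl hu.1.1 huc' hcb hu.2 (hl u hu.1 h' huc)
  rcases hcb.eq_or_lt with h | h
  · rwa [h] at hcS
  obtain ⟨ε, hε, hr⟩ := hright c ⟨hac, h⟩
  have hv1 : c < min b (c + ε / 2) := lt_min h (by linarith)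
  have hv2 : min b (c + ε / 2) ≤ b := min_le_left _ _
  have hv3 : min b (c + ε / 2) < c + ε := lt_of_le_of_lt (min_le_right _ _) (by linarith)
  have hvI : min b (c + ε / 2) ∈ Icc a b := ⟨hac.trans hv1.le, hv2⟩
  have hvS : min b (c + ε / 2) ∈ S :=
    ⟨hvI, htrans a c _ le_rfl hac hv1.le hv2 hcS (hr _ hvI hv1 hv3)⟩
  exact absurd (le_csSup hbdd hvS) (not_le.2 hv1)

namespace KurzweilPartition

variable {X : Type*} [AddCommGroup X] {a b c : ℝ}

/-- The partition of a degenerate interval. -/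
def trivial (a : ℝ) : KurzweilPartition a a where
  ν := 0
  pt := fun _ => a
  tag := fun _ => a
  pt_zero := rfl
  pt_last := rfl
  pt_lt := by simp
  tag_mem := by simp

/-- The partition with one subinterval. -/
def single {a b : ℝ} (hab : a < b) (τ : ℝ) (hτ : τ ∈ Icc a b) : KurzweilPartition a b where
  ν := 1
  pt := fun j => if j = 0 then a else b
  tag := fun _ => τ
  pt_zero := rfl
  pt_last := rfl
  pt_lt := by intro j hj; obtain rfl : j = 0 := by omega
              simpa using hab
  tag_mem := by intro j hj; obtain rfl : j = 0 := by omega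
                simpa using hτ

theorem pt_succ_eq (P : KurzweilPartition a b) {j : ℕ} (hj : j < P.ν) (h : ¬j + 1 < P.ν) :
    P.pt (j + 1) = b := by
  rw [show j + 1 = P.ν by omega, P.pt_last]

/-- Concatenation of partitions. -/
def append (P : KurzweilPartition a b) (Q : KurzweilPartition b c) : KurzweilPartition a c where
  ν := P.ν + Q.ν
  -- The junction index `P.ν` is read from `Q`; both partitions have the point `b` there.
  pt := fun j => if j < P.ν then P.pt j else Q.pt (j - P.ν)
  tag := fun j => if j < P.ν then P.tag j else Q.tag (j - P.ν)
  pt_zero := by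
    split_ifs with h
    · exact P.pt_zero
    · have h0 : P.ν = 0 := by omega
      have h1 := P.pt_last
      rw [h0, P.pt_zero] at h1
      simp [Q.pt_zero, h1]
  pt_last := by simp [Q.pt_last]
  pt_lt := by
    intro j hj
    by_cases h : j + 1 < P.ν
    · rw [if_pos (by omega), if_pos h]; exact P.pt_lt j (by omega)
    by_cases h' : j < P.ν
    · rw [if_pos h', if_neg h, show j + 1 - P.ν = 0 by omega, Q.pt_zero]
      exact (P.pt_lt j h').trans_eq (P.pt_succ_eq h' h)
    · rw [if_neg h', if_neg h, show j + 1 - P.ν = j - P.ν + 1 by omega]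
      exact Q.pt_lt _ (by omega)
  tag_mem := by
    intro j hj
    by_cases h : j + 1 < P.ν
    · rw [if_pos (by omega), if_pos h, if_pos (by omega)]; exact P.tag_mem j (by omega)
    by_cases h' : j < P.ν
    · rw [if_pos h', if_pos h', if_neg h, show j + 1 - P.ν = 0 by omega, Q.pt_zero]
      exact ⟨(P.tag_mem j h').1, (P.tag_mem j h').2.trans_eq (P.pt_succ_eq h' h)⟩
    · rw [if_neg h', if_neg h', if_neg h, show j + 1 - P.ν = j - P.ν + 1 by omega]
      exact Q.tag_mem _ (by omega)

theorem append_left (P : KurzweilPartition a b) (Q : KurzweilPartition b c) {j : ℕ}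
    (hj : j < P.ν) : (P.append Q).pt j = P.pt j ∧ (P.append Q).pt (j + 1) = P.pt (j + 1) ∧
      (P.append Q).tag j = P.tag j := by
  refine ⟨if_pos hj, ?_, if_pos hj⟩
  by_cases h : j + 1 < P.ν
  · exact if_pos h
  · have : (P.append Q).pt (j + 1) = Q.pt (j + 1 - P.ν) := if_neg h
    rw [this, show j + 1 - P.ν = 0 by omega, Q.pt_zero, P.pt_succ_eq hj h]

theorem append_right (P : KurzweilPartition a b) (Q : KurzweilPartition b c) (j : ℕ) :
    (P.append Q).pt (P.ν + j) = Q.pt j ∧ (P.append Q).tag (P.ν + j) = Q.tag j := by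
  simp [append]

theorem riemannSum_append (P : KurzweilPartition a b) (Q : KurzweilPartition b c)
    (G : ℝ → ℝ → X) : (P.append Q).riemannSum G = P.riemannSum G + Q.riemannSum G := by
  have hν : (P.append Q).ν = P.ν + Q.ν := rfl
  unfold riemannSum
  rw [hν, Finset.sum_range_add]
  congr 1
  · refine Finset.sum_congr rfl fun j hj => ?_
    obtain ⟨h1, h2, h3⟩ := append_left P Q (Finset.mem_range.1 hj)
    rw [h1, h2, h3]
  · refine Finset.sum_congr rfl fun j _ => ?_
    rw [add_assoc, (append_right P Q j).1, (append_right P Q (j + 1)).1, (append_right P Q j).2]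

theorem IsFine.append {P : KurzweilPartition a b} {Q : KurzweilPartition b c} {δ : ℝ → ℝ}
    (hP : P.IsFine δ) (hQ : Q.IsFine δ) : (P.append Q).IsFine δ := by
  intro j hj
  have hν : (P.append Q).ν = P.ν + Q.ν := rfl
  by_cases h : j < P.ν
  · obtain ⟨h1, h2, h3⟩ := append_left P Q h
    rw [h1, h2, h3]; exact hP j h
  · obtain ⟨i, rfl⟩ := Nat.exists_eq_add_of_le (not_lt.1 h)
    rw [add_assoc, (append_right P Q i).1, (append_right P Q (i + 1)).1, (append_right P Q i).2]
    exact hQ i (by omega)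

theorem IsFine.mono {P : KurzweilPartition a b} {δ δ' : ℝ → ℝ} (h : ∀ t, δ t ≤ δ' t)
    (hP : P.IsFine δ) : P.IsFine δ' := fun j hj =>
  (hP j hj).trans (Ioo_subset_Ioo (by linarith [h (P.tag j)]) (by linarith [h (P.tag j)]))

theorem isFine_single (hab : a < b) {τ : ℝ} (hτ : τ ∈ Icc a b) {δ : ℝ → ℝ}
    (h1 : τ - δ τ < a) (h2 : b < τ + δ τ) : (single hab τ hτ).IsFine δ := by
  intro j hj
  obtain rfl : j = 0 := by have : (single hab τ hτ).ν = 1 := rfl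
                           omega
  exact Icc_subset_Ioo h1 h2

theorem riemannSum_single (hab : a < b) {τ : ℝ} (hτ : τ ∈ Icc a b) (G : ℝ → ℝ → X) :
    (single hab τ hτ).riemannSum G = G τ b - G τ a := by
  simp [riemannSum, single]

theorem pt_mono (P : KurzweilPartition a b) {i j : ℕ} (hij : i ≤ j) (hj : j ≤ P.ν) :
    P.pt i ≤ P.pt j := by
  induction j, hij using Nat.le_induction with
  | base => exact le_rfl
  | succ k hk ih => exact (ih (by omega)).trans (P.pt_lt k (by omega)).le

theorem pt_mem (P : KurzweilPartition a b) {j : ℕ} (hj : j ≤ P.ν) : P.pt j ∈ Icc a b :=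
  ⟨by simpa [P.pt_zero] using P.pt_mono (Nat.zero_le j) hj,
    by simpa [P.pt_last] using P.pt_mono hj le_rfl⟩

theorem tag_mem_Icc (P : KurzweilPartition a b) {j : ℕ} (hj : j < P.ν) : P.tag j ∈ Icc a b :=
  ⟨(P.pt_mem hj.le).1.trans (P.tag_mem j hj).1, (P.tag_mem j hj).2.trans (P.pt_mem hj).2⟩

/-- A sum over a partition telescopes. -/
theorem sum_sub (P : KurzweilPartition a b) (F : ℝ → X) :
    ∑ j ∈ Finset.range P.ν, (F (P.pt (j + 1)) - F (P.pt j)) = F b - F a := by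
  rw [Finset.sum_range_sub (fun j => F (P.pt j)), P.pt_last, P.pt_zero]

/-- Cousin's lemma. -/
theorem exists_isFine {δ : ℝ → ℝ} (hab : a ≤ b) (hδ : ∀ t ∈ Icc a b, 0 < δ t) :
    ∃ P : KurzweilPartition a b, P.IsFine δ := by
  refine Icc_induction hab (R := fun u v => ∃ P : KurzweilPartition u v, P.IsFine δ) ?_ ?_ ?_ ?_
  · exact fun t _ => ⟨trivial t, fun j hj => absurd hj (Nat.not_lt_zero j)⟩
  · rintro u v w - - - - ⟨P, hP⟩ ⟨Q, hQ⟩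
    exact ⟨P.append Q, hP.append hQ⟩
  · intro t ht
    have h := hδ t ⟨ht.1.le, ht.2⟩
    exact ⟨δ t, h, fun u _ hut hu => ⟨single hut t (right_mem_Icc.2 hut.le),
      isFine_single hut _ hu (by linarith)⟩⟩
  · intro t ht
    have h := hδ t ⟨ht.1, ht.2.le⟩
    exact ⟨δ t, h, fun v _ htv hv => ⟨single htv t (left_mem_Icc.2 htv.le),
      isFine_single htv _ (by linarith) hv⟩⟩

end KurzweilPartition

/-! ### Elementary properties of the Kurzweil integral. -/

namespace HasKurzweilIntegral

open KurzweilPartition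

variable {X : Type*} [NormedAddCommGroup X] {G : ℝ → ℝ → X} {a b c : ℝ} {I I' : X}

/-- Riemann sums over partitions finer than a given gauge approximate the integral. -/
theorem exists_partition (h : HasKurzweilIntegral G a b I) (hab : a ≤ b) {δ : ℝ → ℝ}
    (hδ : ∀ t ∈ Icc a b, 0 < δ t) {ε : ℝ} (hε : 0 < ε) :
    ∃ P : KurzweilPartition a b, P.IsFine δ ∧ ‖P.riemannSum G - I‖ < ε := by
  obtain ⟨δ', hδ', h'⟩ := h ε hε
  obtain ⟨P, hP⟩ := exists_isFine (δ := fun t => min (δ t) (δ' t)) hab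
    fun t ht => lt_min (hδ t ht) (hδ' t ht)
  exact ⟨P, hP.mono fun t => min_le_left _ _, h' P (hP.mono fun t => min_le_right _ _)⟩

/-- A fine partition of `[a, c]` with nearly exact sum is put in front of any fine partition of `[c,
b]`. The gauge of `[a, b]` thus serves on `[c, b]`, without a Cauchy criterion. -/
theorem of_left (h1 : HasKurzweilIntegral G a c I') (h : HasKurzweilIntegral G a b I)
    (hac : a ≤ c) (hcb : c ≤ b) : HasKurzweilIntegral G c b (I - I') := by
  intro ε hε
  obtain ⟨δ, hδ, hδ'⟩ := h (ε / 2) (half_pos hε)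
  refine ⟨δ, fun t ht => hδ t ⟨hac.trans ht.1, ht.2⟩, fun Q hQ => ?_⟩
  obtain ⟨P, hP, hP'⟩ := h1.exists_partition hac (fun t ht => hδ t ⟨ht.1, ht.2.trans hcb⟩)
    (half_pos hε)
  have h3 := hδ' _ (hP.append hQ)
  rw [riemannSum_append] at h3
  calc ‖Q.riemannSum G - (I - I')‖
      = ‖(P.riemannSum G + Q.riemannSum G - I) - (P.riemannSum G - I')‖ := by congr 1; abel
    _ ≤ _ := norm_sub_le _ _
    _ < ε := by linarith

theorem of_right (h1 : HasKurzweilIntegral G c b I') (h : HasKurzweilIntegral G a b I)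
    (hac : a ≤ c) (hcb : c ≤ b) : HasKurzweilIntegral G a c (I - I') := by
  intro ε hε
  obtain ⟨δ, hδ, hδ'⟩ := h (ε / 2) (half_pos hε)
  refine ⟨δ, fun t ht => hδ t ⟨ht.1, ht.2.trans hcb⟩, fun Q hQ => ?_⟩
  obtain ⟨P, hP, hP'⟩ := h1.exists_partition hcb (fun t ht => hδ t ⟨hac.trans ht.1, ht.2⟩)
    (half_pos hε)
  have h3 := hδ' _ (hQ.append hP)
  rw [riemannSum_append] at h3
  calc ‖Q.riemannSum G - (I - I')‖
      = ‖(Q.riemannSum G + P.riemannSum G - I) - (P.riemannSum G - I')‖ := by congr 1; abel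
    _ ≤ _ := norm_sub_le _ _
    _ < ε := by linarith

theorem self_eq_zero (h : HasKurzweilIntegral G a a I) : I = 0 := by
  rw [← norm_le_zero_iff]
  refine le_of_forall_pos_lt_add fun ε hε => ?_
  obtain ⟨δ, -, h'⟩ := h ε hε
  simpa [KurzweilPartition.riemannSum, KurzweilPartition.trivial] using
    h' (KurzweilPartition.trivial a) fun j hj => absurd hj (Nat.not_lt_zero j)

theorem congr {G' : ℝ → ℝ → X} (h : HasKurzweilIntegral G a b I)
    (hG : ∀ τ ∈ Icc a b, ∀ t ∈ Icc a b, G τ t = G' τ t) : HasKurzweilIntegral G' a b I := by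
  intro ε hε
  obtain ⟨δ, hδ, h'⟩ := h ε hε
  refine ⟨δ, hδ, fun P hP => ?_⟩
  have : P.riemannSum G' = P.riemannSum G := Finset.sum_congr rfl fun j hj => by
    have hj := Finset.mem_range.1 hj
    rw [hG _ (P.tag_mem_Icc hj) _ (P.pt_mem hj), hG _ (P.tag_mem_Icc hj) _ (P.pt_mem hj.le)]
  rw [this]; exact h' P hP

theorem sub {G' : ℝ → ℝ → X} (h : HasKurzweilIntegral G a b I)
    (h' : HasKurzweilIntegral G' a b I') :
    HasKurzweilIntegral (fun τ t => G τ t - G' τ t) a b (I - I') := by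
  intro ε hε
  obtain ⟨δ, hδ, h1⟩ := h (ε / 2) (half_pos hε)
  obtain ⟨δ', hδ', h2⟩ := h' (ε / 2) (half_pos hε)
  refine ⟨fun t => min (δ t) (δ' t), fun t ht => lt_min (hδ t ht) (hδ' t ht), fun P hP => ?_⟩
  have e1 := h1 P (hP.mono fun t => min_le_left _ _)
  have e2 := h2 P (hP.mono fun t => min_le_right _ _)
  have : P.riemannSum (fun τ t => G τ t - G' τ t) = P.riemannSum G - P.riemannSum G' := by
    unfold riemannSum
    rw [← Finset.sum_sub_distrib]
    exact Finset.sum_congr rfl fun j _ => sub_sub_sub_comm _ _ _ _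
  calc ‖P.riemannSum (fun τ t => G τ t - G' τ t) - (I - I')‖
      = ‖(P.riemannSum G - I) - (P.riemannSum G' - I')‖ := by rw [this]; congr 1; abel
    _ ≤ _ := norm_sub_le _ _
    _ < ε := by linarith

theorem map {Y : Type*} [NormedAddCommGroup Y] [NormedSpace ℝ X] [NormedSpace ℝ Y]
    (L : X →L[ℝ] Y) (h : HasKurzweilIntegral G a b I) :
    HasKurzweilIntegral (fun τ t => L (G τ t)) a b (L I) := by
  intro ε hε
  have hL : 0 < ‖L‖ + 1 := by positivity
  obtain ⟨δ, hδ, h1⟩ := h (ε / (‖L‖ + 1)) (by positivity)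
  refine ⟨δ, hδ, fun P hP => ?_⟩
  have : P.riemannSum (fun τ t => L (G τ t)) = L (P.riemannSum G) := by
    simp [riemannSum, map_sum]
  rw [this, ← map_sub]
  calc ‖L (P.riemannSum G - I)‖ ≤ ‖L‖ * ‖P.riemannSum G - I‖ := L.le_opNorm _
    _ ≤ (‖L‖ + 1) * ‖P.riemannSum G - I‖ := by gcongr; linarith
    _ < (‖L‖ + 1) * (ε / (‖L‖ + 1)) := by gcongr; exact h1 P hP
    _ = ε := by field_simp

/-- The norm of the integral is at most the increment of a control of the integrand. -/
theorem norm_le (h : HasKurzweilIntegral G a b I) (hab : a ≤ b) {W : ℝ → ℝ}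
    (hG : ∀ u v τ, a ≤ u → u ≤ v → v ≤ b → τ ∈ Icc u v → ‖G τ v - G τ u‖ ≤ W v - W u) :
    ‖I‖ ≤ W b - W a := by
  refine le_of_forall_pos_le_add fun ε hε => ?_
  obtain ⟨P, -, hP⟩ := h.exists_partition (δ := fun _ => 1) hab (fun _ _ => one_pos) hε
  have : ‖P.riemannSum G‖ ≤ W b - W a := by
    rw [← P.sum_sub W]
    refine norm_sum_le_of_le _ fun j hj => ?_
    have hj := Finset.mem_range.1 hj
    exact hG _ _ _ (P.pt_mem hj.le).1 (P.pt_lt j hj).le (P.pt_mem hj).2 (P.tag_mem j hj)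
  have h2 := norm_sub_norm_le I (P.riemannSum G)
  rw [norm_sub_rev] at h2
  linarith

/-- A function that is locally approximated by `G`, to first order with respect to a real
function `W`, is an indefinite Kurzweil integral of `G`. -/
theorem of_primitive {F : ℝ → X} {W : ℝ → ℝ}
    (hr : ∀ ε > 0, ∀ τ ∈ Icc a b, ∃ δ > 0, ∀ v ∈ Icc a b, τ ≤ v → v < τ + δ →
      ‖F v - F τ - (G τ v - G τ τ)‖ ≤ ε * (W v - W τ))
    (hl : ∀ ε > 0, ∀ τ ∈ Icc a b, ∃ δ > 0, ∀ u ∈ Icc a b, u ≤ τ → τ - δ < u →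
      ‖F τ - F u - (G τ τ - G τ u)‖ ≤ ε * (W τ - W u)) :
    HasKurzweilIntegral G a b (F b - F a) := by
  intro ε hε
  -- The local errors sum to at most `η * (W b - W a)`; the `+ 1` keeps the final bound strict and
  -- the quotient defined when `W b = W a`.
  set η := ε / (|W b - W a| + 1) with hη
  have hpos : 0 < |W b - W a| + 1 := by positivity
  have hη0 : 0 < η := by positivity
  choose! δ₁ hδ₁ h1 using hr η hη0
  choose! δ₂ hδ₂ h2 using hl η hη0
  refine ⟨fun t => min (δ₁ t) (δ₂ t), fun t ht => lt_min (hδ₁ t ht) (hδ₂ t ht), fun P hP => ?_⟩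
  have key : ‖P.riemannSum G - (F b - F a)‖ ≤ η * (W b - W a) := by
    rw [← P.sum_sub F, ← P.sum_sub W, riemannSum, ← Finset.sum_sub_distrib, Finset.mul_sum]
    refine norm_sum_le_of_le _ fun j hj => ?_
    have hj := Finset.mem_range.1 hj
    have hτ := P.tag_mem_Icc hj
    have hfine := hP j hj
    have hv := (hfine (right_mem_Icc.2 (P.pt_lt j hj).le)).2
    have hu := (hfine (left_mem_Icc.2 (P.pt_lt j hj).le)).1
    have e1 := h1 _ hτ _ (P.pt_mem hj) (P.tag_mem j hj).2
      (hv.trans_le (by linarith [min_le_left (δ₁ (P.tag j)) (δ₂ (P.tag j))]))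
    have e2 := h2 _ hτ _ (P.pt_mem hj.le) (P.tag_mem j hj).1
      (lt_of_le_of_lt (by linarith [min_le_right (δ₁ (P.tag j)) (δ₂ (P.tag j))]) hu)
    generalize P.tag j = τ at *
    generalize P.pt j = u at *
    generalize P.pt (j + 1) = v at *
    calc ‖G τ v - G τ u - (F v - F u)‖
        = ‖(F v - F τ - (G τ v - G τ τ)) + (F τ - F u - (G τ τ - G τ u))‖ := by
          rw [← norm_neg]; congr 1; abel
      _ ≤ _ := norm_add_le _ _
      _ ≤ η * (W v - W u) := by linarith
  calc _ ≤ η * (W b - W a) := key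
    _ ≤ η * |W b - W a| := by gcongr; exact le_abs_self _
    _ < η * (|W b - W a| + 1) := by gcongr; linarith
    _ = ε := by rw [hη]; field_simp

end HasKurzweilIntegral

/-! ### Fundamental theorem of calculus for Lipschitz functions. -/

section FTC

variable {X : Type*} [NormedAddCommGroup X] [NormedSpace ℝ X] [FiniteDimensional ℝ X]

theorem LipschitzWith.intervalIntegrable_deriv {f : ℝ → X} {C : ℝ≥0} (hf : LipschitzWith C f)
    (p q : ℝ) : IntervalIntegrable (deriv f) volume p q := by
  have : CompleteSpace X := FiniteDimensional.complete ℝ X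
  refine (intervalIntegrable_const (c := (C : ℝ))).mono_fun
    (stronglyMeasurable_deriv f).aestronglyMeasurable ?_
  exact Eventually.of_forall fun r => by
    simpa using norm_deriv_le_of_lipschitz hf

/-- The fundamental theorem of calculus for Lipschitz functions. -/
theorem LipschitzWith.integral_deriv_eq_sub {f : ℝ → X} {C : ℝ≥0} (hf : LipschitzWith C f)
    (p q : ℝ) : ∫ r in p..q, deriv f r = f q - f p := by
  have : CompleteSpace X := FiniteDimensional.complete ℝ X
  -- Functionals reduce the claim to real-valued functions, which are absolutely continuous when
  -- Lipschitz.
  refine (SeparatingDual.eq_iff_forall_dual_eq (R := ℝ)).2 fun φ => ?_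
  rw [← φ.intervalIntegral_comp_comm (hf.intervalIntegrable_deriv p q), map_sub]
  have hφ : LipschitzWith (‖φ‖₊ * C) (fun r => φ (f r)) := φ.lipschitz.comp hf
  rw [← hφ.lipschitzOnWith.absolutelyContinuousOnInterval.integral_deriv_eq_sub]
  refine intervalIntegral.integral_congr_ae ?_
  filter_upwards [hf.ae_differentiableAt_real] with r hr _
  exact (φ.hasFDerivAt.comp_hasDerivAt r hr.hasDerivAt).deriv.symm

end FTC

/-! ### The change of time and its generalized inverse. -/

/-- A factorization `A = B ∘ W` on `[0, ∞)` of a function of locally bounded variation through a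
Lipschitz function and a strictly increasing change of time. -/
structure TimeChange {X : Type*} [NormedAddCommGroup X] (A : ℝ → X) where
  W : ℝ → ℝ
  B : ℝ → X
  C : ℝ≥0
  -- Growth of slope at least one makes `W` strictly increasing and unbounded on both sides, so the
  -- supremum defining `T` is over a nonempty bounded set.
  mono : Monotone fun t => W t - t
  lip : LipschitzWith C B
  eq : ∀ t, 0 ≤ t → A t = B (W t)

theorem LocallyBoundedVariationOn.nonempty_timeChange {X : Type*} [NormedAddCommGroup X]
    [NormedSpace ℝ X] [FiniteDimensional ℝ X] {A : ℝ → X}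
    (hA : LocallyBoundedVariationOn A (Ici 0)) : Nonempty (TimeChange A) := by
  have h0 : (0 : ℝ) ∈ Ici (0 : ℝ) := self_mem_Ici
  -- The cutoff `max t 0` extends the variation by zero to negative times.
  set V : ℝ → ℝ := fun t => variationOnFromTo A (Ici 0) 0 (max t 0) with hV
  have hVm : Monotone V := fun s t hst =>
    variationOnFromTo.monotoneOn hA h0 (mem_Ici.2 (le_max_right _ _)) (mem_Ici.2 (le_max_right _ _))
      (max_le_max_right 0 hst)
  set W : ℝ → ℝ := fun t => V t + t with hW
  have hWs : StrictMono W := hVm.add_strictMono strictMono_id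
  have hdist : ∀ u v, 0 ≤ u → u ≤ v → ‖A v - A u‖ ≤ W v - W u := by
    intro u v hu huv
    have hv := hu.trans huv
    have h1 : dist (A u) (A v) ≤ variationOnFromTo A (Ici 0) u v := by
      rw [variationOnFromTo.eq_of_le _ _ huv, dist_edist]
      exact ENNReal.toReal_mono (hA u v hu hv)
        (eVariationOn.edist_le A ⟨hu, le_rfl, huv⟩ ⟨hv, huv, le_rfl⟩)
    have h2 := variationOnFromTo.add hA h0 (show u ∈ Ici (0 : ℝ) from hu)
      (show v ∈ Ici (0 : ℝ) from hv)
    rw [← dist_eq_norm, dist_comm]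
    simp only [hW, hV, max_eq_left hu, max_eq_left hv]
    linarith
  have hlip : LipschitzOnWith 1 (fun r => A (Function.invFun W r)) (W '' Ici 0) := by
    refine LipschitzOnWith.of_dist_le_mul ?_
    rintro _ ⟨u, hu, rfl⟩ _ ⟨v, hv, rfl⟩
    simp only [Function.leftInverse_invFun hWs.injective u,
      Function.leftInverse_invFun hWs.injective v, NNReal.coe_one, one_mul]
    rcases le_total u v with h | h
    · rw [dist_comm, dist_comm (W u), dist_eq_norm, Real.dist_eq,
        abs_of_nonneg (sub_nonneg.2 (hWs.monotone h))]
      exact hdist u v hu h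
    · rw [dist_eq_norm, Real.dist_eq, abs_of_nonneg (sub_nonneg.2 (hWs.monotone h))]
      exact hdist v u hv h
  -- The image of `W` has gaps at the jumps; finite dimension allows a Lipschitz extension across
  -- them, possibly with a larger constant.
  obtain ⟨B, hB, hB'⟩ := hlip.extend_finite_dimension
  refine ⟨⟨W, B, _, ?_, hB, fun t ht => ?_⟩⟩
  · simpa [hW] using hVm
  · rw [← hB' ⟨t, ht, rfl⟩]
    simp only [Function.leftInverse_invFun hWs.injective t]

namespace TimeChange

section Basic

variable {X : Type*} [NormedAddCommGroup X] {A : ℝ → X} (Z : TimeChange A)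

theorem strictMono : StrictMono Z.W := by
  intro s t hst
  have := Z.mono hst.le
  simp only at this
  linarith

theorem monotone : Monotone Z.W := Z.strictMono.monotone

theorem norm_sub_le {p q : ℝ} (hpq : p ≤ q) : ‖Z.B q - Z.B p‖ ≤ Z.C * (q - p) := by
  simpa [dist_eq_norm, Real.dist_eq, abs_of_nonneg (sub_nonneg.2 hpq)] using Z.lip.dist_le_mul q p

/-- The generalized inverse of the change of time. -/
noncomputable def T (r : ℝ) : ℝ := sSup {t | Z.W t ≤ r}

theorem exists_W_le (r : ℝ) : ∃ t, Z.W t ≤ r := by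
  refine ⟨min 0 (r - Z.W 0), ?_⟩
  have := Z.mono (min_le_left 0 (r - Z.W 0))
  simp only at this
  linarith [min_le_right 0 (r - Z.W 0)]

theorem exists_lt_W (r : ℝ) : ∃ t, r < Z.W t := by
  refine ⟨max 0 (r - Z.W 0 + 1), ?_⟩
  have := Z.mono (le_max_left 0 (r - Z.W 0 + 1))
  simp only at this
  linarith [le_max_right 0 (r - Z.W 0 + 1)]

theorem bddAbove_W_le (r : ℝ) : BddAbove {t | Z.W t ≤ r} := by
  obtain ⟨v, hv⟩ := Z.exists_lt_W r
  exact ⟨v, fun t ht => (Z.strictMono.lt_iff_lt.1 (lt_of_le_of_lt ht hv)).le⟩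

theorem le_T {u r : ℝ} (h : Z.W u ≤ r) : u ≤ Z.T r := le_csSup (Z.bddAbove_W_le r) h

theorem T_le {v r : ℝ} (h : r < Z.W v) : Z.T r ≤ v :=
  csSup_le (Z.exists_W_le r) fun _ ht => (Z.strictMono.lt_iff_lt.1 (lt_of_le_of_lt ht h)).le

theorem T_le_of_le {v r : ℝ} (h : r ≤ Z.W v) : Z.T r ≤ v :=
  le_of_forall_gt_imp_ge_of_dense fun _ hw => Z.T_le (h.trans_lt (Z.strictMono hw))

theorem T_mem {u v r : ℝ} (h : r ∈ Icc (Z.W u) (Z.W v)) : Z.T r ∈ Icc u v :=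
  ⟨Z.le_T h.1, Z.T_le_of_le h.2⟩

theorem monotone_T : Monotone Z.T := fun _ s hrs =>
  csSup_le_csSup (Z.bddAbove_W_le s) (Z.exists_W_le _) fun _ ht => le_trans ht hrs

/-- The right limit of the change of time. -/
noncomputable def Wr (t : ℝ) : ℝ := Function.rightLim Z.W t

/-- The left limit of the change of time. -/
noncomputable def Wl (t : ℝ) : ℝ := Function.leftLim Z.W t

theorem tendsto_Wr (t : ℝ) : Tendsto Z.W (𝓝[>] t) (𝓝 (Z.Wr t)) := Z.monotone.tendsto_rightLim t

theorem tendsto_Wl (t : ℝ) : Tendsto Z.W (𝓝[<] t) (𝓝 (Z.Wl t)) := Z.monotone.tendsto_leftLim t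

theorem W_le_Wr (t : ℝ) : Z.W t ≤ Z.Wr t := Z.monotone.le_rightLim le_rfl

theorem Wl_le_W (t : ℝ) : Z.Wl t ≤ Z.W t := Z.monotone.leftLim_le le_rfl

theorem Wr_le_W {t v : ℝ} (h : t < v) : Z.Wr t ≤ Z.W v := Z.monotone.rightLim_le h

theorem W_le_Wl {u t : ℝ} (h : u < t) : Z.W u ≤ Z.Wl t := Z.monotone.le_leftLim h

theorem Wr_le_Wl {u t : ℝ} (h : u < t) : Z.Wr u ≤ Z.Wl t := Z.monotone.rightLim_le_leftLim h

/-- Inverse time stands still while `W` jumps: this is how a jump of `A` becomes an integral with a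
constant value of the solution. -/
theorem T_eq_of_lt_Wr {t r : ℝ} (h : Z.W t ≤ r) (h' : r < Z.Wr t) : Z.T r = t :=
  le_antisymm (le_of_forall_gt_imp_ge_of_dense fun _ hv => Z.T_le (h'.trans_le (Z.Wr_le_W hv)))
    (Z.le_T h)

theorem T_eq_of_Wl_le {t r : ℝ} (h : Z.Wl t ≤ r) (h' : r < Z.W t) : Z.T r = t :=
  le_antisymm (Z.T_le h') (le_of_forall_lt_imp_le_of_dense fun _ hu =>
    Z.le_T ((Z.W_le_Wl hu).trans h))

theorem lt_T {t r : ℝ} (h : Z.Wr t < r) : t < Z.T r := by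
  obtain ⟨v, hv, hv'⟩ := (((Z.tendsto_Wr t).eventually_lt_const h).and self_mem_nhdsWithin).exists
  exact lt_of_lt_of_le hv' (Z.le_T hv.le)

theorem T_lt {t r : ℝ} (h : r < Z.Wl t) : Z.T r < t := by
  obtain ⟨v, hv, hv'⟩ := (((Z.tendsto_Wl t).eventually_const_lt h).and self_mem_nhdsWithin).exists
  exact lt_of_le_of_lt (Z.T_le hv) hv'

/-- Once the jump at `t` is split off, the growth of `W` is arbitrarily small. This smallness drives
the contraction, the choice of gauges and uniqueness. -/
theorem exists_right (t : ℝ) {ε : ℝ} (hε : 0 < ε) :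
    ∃ δ > 0, ∀ v, t < v → v < t + δ → Z.W v - Z.Wr t < ε := by
  obtain ⟨b, hb, h⟩ := (mem_nhdsGT_iff_exists_Ioo_subset).1
    ((Z.tendsto_Wr t).eventually_lt_const (show Z.Wr t < Z.Wr t + ε by linarith))
  exact ⟨b - t, sub_pos.2 hb, fun v h1 h2 => by
    have : Z.W v < Z.Wr t + ε := h ⟨h1, by linarith⟩
    linarith⟩

theorem exists_left (t : ℝ) {ε : ℝ} (hε : 0 < ε) :
    ∃ δ > 0, ∀ u, u < t → t - δ < u → Z.Wl t - Z.W u < ε := by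
  obtain ⟨b, hb, h⟩ := (mem_nhdsLT_iff_exists_Ioo_subset).1
    ((Z.tendsto_Wl t).eventually_const_lt (show Z.Wl t - ε < Z.Wl t by linarith))
  exact ⟨t - b, sub_pos.2 hb, fun u h1 h2 => by
    have : Z.Wl t - ε < Z.W u := h ⟨by linarith, h1⟩
    linarith⟩

theorem tendsto_right {t : ℝ} (ht : 0 ≤ t) : Tendsto A (𝓝[>] t) (𝓝 (Z.B (Z.Wr t))) := by
  refine ((Z.lip.continuous.tendsto _).comp (Z.tendsto_Wr t)).congr' ?_
  filter_upwards [self_mem_nhdsWithin] with v hv using (Z.eq v (ht.trans (le_of_lt hv))).symm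

theorem tendsto_left {t : ℝ} (ht : 0 < t) : Tendsto A (𝓝[<] t) (𝓝 (Z.B (Z.Wl t))) := by
  refine ((Z.lip.continuous.tendsto _).comp (Z.tendsto_Wl t)).congr' ?_
  filter_upwards [Ioo_mem_nhdsLT ht] with v hv using (Z.eq v hv.1.le).symm

theorem rightLim_eq {t : ℝ} (ht : 0 ≤ t) : Function.rightLim A t = Z.B (Z.Wr t) :=
  rightLim_eq_of_tendsto (Z.tendsto_right ht)

theorem leftLim_eq {t : ℝ} (ht : 0 < t) : Function.leftLim A t = Z.B (Z.Wl t) :=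
  leftLim_eq_of_tendsto (Z.tendsto_left ht)

end Basic

end TimeChange

/-! ### The contraction argument for the integral equation. -/

section Contraction

variable {R : Type*} [NormedRing R]

theorem intervalIntegrable_mul_of_bound {h y : ℝ → R} {C M : ℝ} (hh : StronglyMeasurable h)
    (hC : ∀ r, ‖h r‖ ≤ C) (hy : StronglyMeasurable y) (hM : ∀ r, ‖y r‖ ≤ M) (p q : ℝ) :
    IntervalIntegrable (fun r => h r * y r) volume p q := by
  refine (intervalIntegrable_const (c := C * M)).mono_fun (hh.mul hy).aestronglyMeasurable ?_
  refine Eventually.of_forall fun r => ?_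
  have hC0 : 0 ≤ C := (norm_nonneg _).trans (hC r)
  exact ((norm_mul_le _ _).trans (mul_le_mul (hC r) (hM r) (norm_nonneg _) hC0)).trans
    (le_abs_self _)

/-- Local solvability of a linear integral equation with a deviating argument. -/
theorem exists_integralEquation_solution [NormedAlgebra ℝ R] [CompleteSpace R] {h : ℝ → R} {C : ℝ}
    (hh : StronglyMeasurable h) (hC : ∀ r, ‖h r‖ ≤ C) {κ : ℝ → ℝ} (hκ : Measurable κ) {p q : ℝ}
    (hpq : p ≤ q) (hs : C * (q - p) ≤ 1 / 2) (ζ : R) :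
    ∃ X : BoundedContinuousFunction ℝ R,
      ∀ σ ∈ Icc p q, X σ = ζ + ∫ r in p..σ, h r * X (κ r) := by
  have hC0 : 0 ≤ C := (norm_nonneg _).trans (hC 0)
  have hmeas : ∀ X : BoundedContinuousFunction ℝ R, StronglyMeasurable fun r => X (κ r) :=
    fun X => X.continuous.comp_stronglyMeasurable hκ.stronglyMeasurable
  have hint : ∀ (X : BoundedContinuousFunction ℝ R) (u v : ℝ),
      IntervalIntegrable (fun r => h r * X (κ r)) volume u v := fun X u v =>
    intervalIntegrable_mul_of_bound hh hC (hmeas X) (fun r => X.norm_coe_le_norm (κ r)) u v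
  -- Clamping to `[p, q]` lets the operator act on the complete space of bounded continuous
  -- functions on the line, wherever `κ` takes its values.
  set cl : ℝ → ℝ := fun σ => max p (min q σ) with hcl
  have hclm : ∀ σ, cl σ ∈ Icc p q := fun σ => ⟨le_max_left _ _, max_le hpq (min_le_left _ _)⟩
  have hclc : Continuous cl := by fun_prop
  have hbound : ∀ (X : BoundedContinuousFunction ℝ R) (σ : ℝ),
      ‖∫ r in p..cl σ, h r * X (κ r)‖ ≤ 1 / 2 * ‖X‖ := by
    intro X σ
    have h1 : ‖∫ r in p..cl σ, h r * X (κ r)‖ ≤ C * ‖X‖ * |cl σ - p| :=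
      intervalIntegral.norm_integral_le_of_norm_le_const fun r _ =>
        (norm_mul_le _ _).trans
          (mul_le_mul (hC r) (X.norm_coe_le_norm (κ r)) (norm_nonneg _) hC0)
    rw [abs_of_nonneg (sub_nonneg.2 (hclm σ).1)] at h1
    calc _ ≤ C * ‖X‖ * (cl σ - p) := h1
      _ ≤ C * ‖X‖ * (q - p) := by
        have := (hclm σ).2
        gcongr
      _ = C * (q - p) * ‖X‖ := by ring
      _ ≤ 1 / 2 * ‖X‖ := by gcongr
  let K : BoundedContinuousFunction ℝ R → BoundedContinuousFunction ℝ R := fun X =>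
    BoundedContinuousFunction.ofNormedAddCommGroup
      (fun σ => ζ + ∫ r in p..cl σ, h r * X (κ r))
      (continuous_const.add ((intervalIntegral.continuous_primitive (hint X) p).comp hclc))
      (‖ζ‖ + 1 / 2 * ‖X‖)
      fun σ => (norm_add_le _ _).trans (by gcongr; exact hbound X σ)
  have hK : ContractingWith (1 / 2) K := by
    refine ⟨by norm_num, LipschitzWith.of_dist_le_mul fun X Y => ?_⟩
    rw [BoundedContinuousFunction.dist_le (by positivity)]
    intro σ
    have e : K X σ - K Y σ = ∫ r in p..cl σ, h r * (X - Y) (κ r) := by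
      change (ζ + ∫ r in p..cl σ, h r * X (κ r)) - (ζ + ∫ r in p..cl σ, h r * Y (κ r)) = _
      rw [add_sub_add_left_eq_sub, ← intervalIntegral.integral_sub (hint X _ _) (hint Y _ _)]
      simp [mul_sub]
    rw [dist_eq_norm, e, dist_eq_norm]
    simpa using hbound (X - Y) σ
  refine ⟨hK.fixedPoint K, fun σ hσ => ?_⟩
  have e : cl σ = σ := by simp [hcl, hσ.1, hσ.2]
  have := congrArg (fun X : BoundedContinuousFunction ℝ R => X σ) hK.fixedPoint_isFixedPt
  rw [← this]
  change ζ + ∫ r in p..cl σ, h r * (hK.fixedPoint K) (κ r) = _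
  rw [e]

end Contraction

/-! ### Solutions in changed time. -/

namespace TimeChange

variable {R : Type*} [NormedRing R] [NormedAlgebra ℝ R] {A : ℝ → R} (Z : TimeChange A)

/-- `x` solves, on `[a, b]`, the linear integral equation in changed time. -/
def IsSolution (a b : ℝ) (x : ℝ → R) : Prop :=
  IntervalIntegrable (fun r => deriv Z.B r * x (Z.T r)) volume (Z.W a) (Z.W b) ∧
    ∀ t ∈ Icc a b, x t = x a + ∫ r in Z.W a..Z.W t, deriv Z.B r * x (Z.T r)

variable {Z} {a b c d : ℝ} {x y : ℝ → R}

theorem norm_deriv_le (r : ℝ) : ‖deriv Z.B r‖ ≤ Z.C := norm_deriv_le_of_lipschitz Z.lip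

theorem IsSolution.intervalIntegrable (hx : Z.IsSolution a b x) {u v : ℝ} (hau : a ≤ u)
    (huv : u ≤ v) (hvb : v ≤ b) :
    IntervalIntegrable (fun r => deriv Z.B r * x (Z.T r)) volume (Z.W u) (Z.W v) := by
  refine hx.1.mono_set ?_
  rw [uIcc_of_le (Z.monotone huv), uIcc_of_le (Z.monotone (hau.trans (huv.trans hvb)))]
  exact Icc_subset_Icc (Z.monotone hau) (Z.monotone hvb)

theorem IsSolution.sub_eq (hx : Z.IsSolution a b x) {u v : ℝ} (hau : a ≤ u)
    (huv : u ≤ v) (hvb : v ≤ b) :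
    x v - x u = ∫ r in Z.W u..Z.W v, deriv Z.B r * x (Z.T r) := by
  rw [hx.2 v ⟨hau.trans huv, hvb⟩, hx.2 u ⟨hau, huv.trans hvb⟩,
    ← intervalIntegral.integral_add_adjacent_intervals
      (hx.intervalIntegrable le_rfl hau (huv.trans hvb)) (hx.intervalIntegrable hau huv hvb)]
  abel

theorem IsSolution.mono (hx : Z.IsSolution a b x) (hac : a ≤ c) (hcd : c ≤ d) (hdb : d ≤ b) :
    Z.IsSolution c d x :=
  ⟨hx.intervalIntegrable hac hcd hdb, fun t ht => by
    rw [← hx.sub_eq hac ht.1 (ht.2.trans hdb)]; abel⟩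

theorem IsSolution.congr (hx : Z.IsSolution a b x) (hab : a ≤ b) (h : ∀ t ∈ Icc a b, x t = y t) :
    Z.IsSolution a b y := by
  have hT : ∀ r ∈ Icc (Z.W a) (Z.W b), x (Z.T r) = y (Z.T r) := fun r hr => h _ (Z.T_mem hr)
  refine ⟨hx.1.congr fun r hr => ?_, fun t ht => ?_⟩
  · rw [uIoc_of_le (Z.monotone hab)] at hr
    simp only [hT r (Ioc_subset_Icc_self hr)]
  · rw [← h t ht, ← h a (left_mem_Icc.2 hab), hx.2 t ht]
    congr 1
    refine intervalIntegral.integral_congr fun r hr => ?_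
    rw [uIcc_of_le (Z.monotone ht.1)] at hr
    simp only [hT r ⟨hr.1, hr.2.trans (Z.monotone ht.2)⟩]

theorem IsSolution.trans (h1 : Z.IsSolution a b x) (h2 : Z.IsSolution b c x) (hab : a ≤ b) :
    Z.IsSolution a c x := by
  refine ⟨h1.1.trans h2.1, fun t ht => ?_⟩
  rcases le_total t b with h | h
  · exact h1.2 t ⟨ht.1, h⟩
  · rw [h2.2 t ⟨h, ht.2⟩, h1.2 b (right_mem_Icc.2 hab),
      ← intervalIntegral.integral_add_adjacent_intervals h1.1
        (h2.intervalIntegrable le_rfl h ht.2), add_assoc]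

theorem IsSolution.glue (h1 : Z.IsSolution a b x) (h2 : Z.IsSolution b c y) (hab : a ≤ b)
    (hbc : b ≤ c) (hxy : x b = y b) : Z.IsSolution a c fun t => if t ≤ b then x t else y t := by
  refine IsSolution.trans (h1.congr hab fun t ht => (if_pos ht.2).symm)
    (h2.congr hbc fun t ht => ?_) hab
  split_ifs with h
  · rw [le_antisymm h ht.1, hxy]
  · rfl

/-- Integrability of the integrand suffices: the integral of its norm bounds every increment from
`a`. -/
theorem IsSolution.exists_bound (hx : Z.IsSolution a b x) (hab : a ≤ b) :
    ∃ M, 0 ≤ M ∧ ∀ t ∈ Icc a b, ‖x t‖ ≤ M := by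
  refine ⟨‖x a‖ + ∫ r in Z.W a..Z.W b, ‖deriv Z.B r * x (Z.T r)‖,
    add_nonneg (norm_nonneg _) (intervalIntegral.integral_nonneg_of_forall (Z.monotone hab)
      fun r => norm_nonneg _), fun t ht => ?_⟩
  rw [hx.2 t ht]
  refine (norm_add_le _ _).trans ?_
  gcongr
  refine (intervalIntegral.norm_integral_le_integral_norm (Z.monotone ht.1)).trans ?_
  exact intervalIntegral.integral_mono_interval le_rfl (Z.monotone ht.1) (Z.monotone ht.2)
    (Eventually.of_forall fun r => norm_nonneg _) hx.1.norm

variable [FiniteDimensional ℝ R]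

theorem intervalIntegrable_deriv_mul (ξ : R) (p q : ℝ) :
    IntervalIntegrable (fun r => deriv Z.B r * ξ) volume p q := by
  have := FiniteDimensional.complete ℝ R
  exact intervalIntegrable_mul_of_bound (stronglyMeasurable_deriv Z.B) norm_deriv_le
    stronglyMeasurable_const (fun _ => le_rfl) p q

theorem integral_deriv_mul (ξ : R) (p q : ℝ) :
    ∫ r in p..q, deriv Z.B r * ξ = (Z.B q - Z.B p) * ξ := by
  have := FiniteDimensional.complete ℝ R
  rw [← Z.lip.integral_deriv_eq_sub]
  exact ((ContinuousLinearMap.mul ℝ R).flip ξ).intervalIntegral_comp_comm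
    (Z.lip.intervalIntegrable_deriv p q)

/-- Local existence of solutions. -/
theorem exists_isSolution (hc : 0 ≤ c) (hcd : c < d)
    (hs : Z.C * (Z.Wl d - Z.Wr c) ≤ 1 / 2) (hu : IsUnit (1 - (A d - Function.leftLim A d)))
    (ζ : R) : ∃ x, Z.IsSolution c d x ∧ x c = ζ := by
  have := FiniteDimensional.complete ℝ R
  obtain ⟨J, hJ⟩ := hu.exists_right_inv
  have hd : 0 < d := hc.trans_lt hcd
  rw [Z.leftLim_eq hd, Z.eq d hd.le] at hJ
  have hcp := Z.W_le_Wr c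
  have hqd := Z.Wl_le_W d
  have hpq := Z.Wr_le_Wl hcd
  have hWp : ∀ t, c < t → Z.Wr c ≤ Z.W t := fun t ht => Z.Wr_le_W ht
  have hWq : ∀ t, t < d → Z.W t ≤ Z.Wl d := fun t ht => Z.W_le_Wl ht
  have e1 : ∀ r ∈ Ioo (Z.W c) (Z.Wr c), Z.T r = c := fun r hr => Z.T_eq_of_lt_Wr hr.1.le hr.2
  have e2 : ∀ r ∈ Ioo (Z.Wr c) (Z.Wl d), c < Z.T r ∧ Z.T r < d :=
    fun r hr => ⟨Z.lt_T hr.1, Z.T_lt hr.2⟩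
  have e3 : ∀ r ∈ Ioo (Z.Wl d) (Z.W d), Z.T r = d := fun r hr => Z.T_eq_of_Wl_le hr.1.le hr.2
  set p := Z.Wr c with hp
  set q := Z.Wl d with hq
  -- The contraction runs strictly between the end jumps, so its initial value is the right limit of
  -- the solution at `c`.
  obtain ⟨X, hX⟩ := exists_integralEquation_solution (stronglyMeasurable_deriv Z.B)
    (norm_deriv_le (Z := Z)) (Z.monotone.measurable.comp Z.monotone_T.measurable) hpq hs
    (ζ + (Z.B p - Z.B (Z.W c)) * ζ)
  simp only [Function.comp_apply] at hX
  -- The value `z` at `d` must satisfy `z = X q + (A d - A(d⁻)) * z`, whence `z = J * X q`.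
  set x : ℝ → R := fun t => if t ≤ c then ζ else if t < d then X (Z.W t) else J * X q with hx
  have xc : x c = ζ := if_pos le_rfl
  have xd : x d = J * X q := by simp [hx, hcd]
  have xm : ∀ t, c < t → t < d → x t = X (Z.W t) := fun t h1 h2 => by simp [hx, h1, h2]
  have g1 : EqOn (fun r => deriv Z.B r * ζ) (fun r => deriv Z.B r * x (Z.T r))
      (Ioo (Z.W c) p) := fun r hr => by simp only [e1 r hr, xc]
  have g2 : EqOn (fun r => deriv Z.B r * X (Z.W (Z.T r))) (fun r => deriv Z.B r * x (Z.T r))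
      (Ioo p q) := fun r hr => by simp only [xm _ (e2 r hr).1 (e2 r hr).2]
  have g3 : EqOn (fun r => deriv Z.B r * (J * X q)) (fun r => deriv Z.B r * x (Z.T r))
      (Ioo q (Z.W d)) := fun r hr => by simp only [e3 r hr, xd]
  have hXint : ∀ u v, IntervalIntegrable (fun r => deriv Z.B r * X (Z.W (Z.T r))) volume u v :=
    intervalIntegrable_mul_of_bound (stronglyMeasurable_deriv Z.B) norm_deriv_le
      (X.continuous.comp_stronglyMeasurable
        (Z.monotone.measurable.comp Z.monotone_T.measurable).stronglyMeasurable)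
      (fun r => X.norm_coe_le_norm _)
  have i1 : IntervalIntegrable (fun r => deriv Z.B r * x (Z.T r)) volume (Z.W c) p :=
    (intervalIntegrable_deriv_mul ζ _ _).congr_uIoo (by rwa [uIoo_of_le hcp])
  have i2 : ∀ σ ∈ Icc p q,
      IntervalIntegrable (fun r => deriv Z.B r * x (Z.T r)) volume p σ := fun σ hσ =>
    (hXint _ _).congr_uIoo (by
      rw [uIoo_of_le hσ.1]; exact g2.mono (Ioo_subset_Ioo_right hσ.2))
  have i3 : IntervalIntegrable (fun r => deriv Z.B r * x (Z.T r)) volume q (Z.W d) :=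
    (intervalIntegrable_deriv_mul (J * X q) _ _).congr_uIoo (by rwa [uIoo_of_le hqd])
  have v2 : ∀ σ ∈ Icc p q, ζ + ∫ r in Z.W c..σ, deriv Z.B r * x (Z.T r) = X σ := by
    intro σ hσ
    rw [hX σ hσ, ← intervalIntegral.integral_add_adjacent_intervals i1 (i2 σ hσ),
      ← intervalIntegral.integral_congr_Ioo_of_le hcp g1, integral_deriv_mul,
      ← intervalIntegral.integral_congr_Ioo_of_le hσ.1 (g2.mono (Ioo_subset_Ioo_right hσ.2)),
      add_assoc]
  refine ⟨x, ⟨(i1.trans (i2 q ⟨hpq, le_rfl⟩)).trans i3, fun t ht => ?_⟩, xc⟩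
  rw [xc]
  rcases ht.1.eq_or_lt with rfl | h1
  · simp [xc]
  rcases ht.2.eq_or_lt with rfl | h2
  · rw [← intervalIntegral.integral_add_adjacent_intervals (i1.trans (i2 q ⟨hpq, le_rfl⟩)) i3,
      ← add_assoc, v2 q ⟨hpq, le_rfl⟩, ← intervalIntegral.integral_congr_Ioo_of_le hqd g3,
      integral_deriv_mul, xd]
    have : X q = (1 - (Z.B (Z.W t) - Z.B q)) * J * X q := by rw [hJ, one_mul]
    nth_rewrite 2 [this]
    noncomm_ring
  · rw [xm t h1 h2, v2 _ ⟨hWp t h1, hWq t h2⟩]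

/-- Existence of solutions on compact intervals. -/
theorem exists_isSolution_Icc (hD : ∀ t, 0 < t → IsUnit (1 - (A t - Function.leftLim A t)))
    (hb : 0 ≤ b) (ζ : R) : ∃ x, Z.IsSolution 0 b x ∧ x 0 = ζ := by
  have hrefl : ∀ t (ζ : R), Z.IsSolution t t fun _ => ζ := fun t ζ => ⟨by simp, fun s hs => by
    simp [le_antisymm hs.2 hs.1]⟩
  have hε : 0 < 1 / (2 * (Z.C + 1) : ℝ) := by positivity
  have hsmall : ∀ r, r < 1 / (2 * (Z.C + 1) : ℝ) → Z.C * r ≤ 1 / 2 := by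
    intro r hr
    rcases le_total r 0 with h | h
    · exact (mul_nonpos_of_nonneg_of_nonpos Z.C.2 h).trans (by norm_num)
    · calc Z.C * r ≤ (Z.C + 1) * (1 / (2 * (Z.C + 1))) := by gcongr; linarith
        _ = 1 / 2 := by field_simp
  -- Solvability for every initial value is what makes the relation transitive.
  refine Icc_induction hb (R := fun u v => ∀ ζ : R, ∃ x, Z.IsSolution u v x ∧ x u = ζ)
    ?_ ?_ ?_ ?_ ζ
  · exact fun t _ ζ => ⟨fun _ => ζ, hrefl t ζ, rfl⟩
  · intro u v w _ huv hvw _ h1 h2 ζ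
    obtain ⟨x, hx, hxu⟩ := h1 ζ
    obtain ⟨y, hy, hyv⟩ := h2 (x v)
    exact ⟨_, hx.glue hy huv hvw hyv.symm, by simp [huv, hxu]⟩
  · intro t ht
    obtain ⟨δ, hδ, h⟩ := Z.exists_left t hε
    exact ⟨δ, hδ, fun u hu hut hu' ζ => exists_isSolution hu.1 hut
      (hsmall _ (lt_of_le_of_lt (by linarith [Z.W_le_Wr u]) (h u hut hu'))) (hD t ht.1) ζ⟩
  · intro t ht
    obtain ⟨δ, hδ, h⟩ := Z.exists_right t hε
    exact ⟨δ, hδ, fun v hv htv hv' ζ => exists_isSolution ht.1 htv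
      (hsmall _ (lt_of_le_of_lt (by linarith [Z.Wl_le_W v]) (h v htv hv')))
      (hD v (ht.1.trans_lt htv)) ζ⟩

/-- Solutions of the integral equation in changed time are Kurzweil solutions. -/
theorem IsSolution.hasKurzweilIntegral (hx : Z.IsSolution a b x) (ha : 0 ≤ a) (hab : a ≤ b) :
    HasKurzweilIntegral (fun τ t => A t * x τ) a b (x b - x a) := by
  have := FiniteDimensional.complete ℝ R
  obtain ⟨M, hM0, hM⟩ := hx.exists_bound hab
  set C : ℝ := NNReal.toReal Z.C with hC
  have hC0 : 0 ≤ C := Z.C.2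
  have hdiff : ∀ u v, a ≤ u → u ≤ v → v ≤ b → ‖x v - x u‖ ≤ C * M * (Z.W v - Z.W u) := by
    intro u v hau huv hvb
    rw [hx.sub_eq hau huv hvb]
    have hW := Z.monotone huv
    have h1 : ‖∫ r in Z.W u..Z.W v, deriv Z.B r * x (Z.T r)‖ ≤ C * M * |Z.W v - Z.W u| :=
      intervalIntegral.norm_integral_le_of_norm_le_const fun r hr => by
        rw [uIoc_of_le hW] at hr
        have hT := Z.T_mem (Ioc_subset_Icc_self hr)
        exact (norm_mul_le _ _).trans (mul_le_mul (norm_deriv_le r)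
          (hM _ ⟨hau.trans hT.1, hT.2.trans hvb⟩) (norm_nonneg _) hC0)
    rwa [abs_of_nonneg (sub_nonneg.2 hW)] at h1
  -- The local error is an integral of `x (T r) - x τ`; it is second order in the growth of `W`,
  -- apart from the jump at `τ`.
  have herr : ∀ u v τ, a ≤ u → u ≤ v → v ≤ b → x v - x u - (A v * x τ - A u * x τ) =
      ∫ r in Z.W u..Z.W v, deriv Z.B r * (x (Z.T r) - x τ) := by
    intro u v τ hau huv hvb
    simp only [mul_sub]
    rw [intervalIntegral.integral_sub (hx.intervalIntegrable hau huv hvb)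
      (intervalIntegrable_deriv_mul _ _ _), ← hx.sub_eq hau huv hvb, integral_deriv_mul,
      ← Z.eq v (by linarith), ← Z.eq u (by linarith), sub_mul]
  have herrint : ∀ u v τ, a ≤ u → u ≤ v → v ≤ b →
      IntervalIntegrable (fun r => deriv Z.B r * (x (Z.T r) - x τ)) volume (Z.W u) (Z.W v) := by
    intro u v τ hau huv hvb
    simp only [mul_sub]
    exact (hx.intervalIntegrable hau huv hvb).sub (intervalIntegrable_deriv_mul _ _ _)
  -- Growth of `W` below `ε / D` past the jump makes the error at most `ε` times the increment of
  -- `W`; the `+ 1` ensures `D > 0`.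
  set D : ℝ := C * (C * M) + 1 with hDdef
  have hD : 0 < D := by positivity
  have fin : ∀ ε s w : ℝ, 0 < ε → 0 ≤ w → 0 ≤ s → s < ε / D → C * (C * M * w) * s ≤ ε * w := by
    intro ε s w hε hw hs0 hs
    have : D * s ≤ ε := by rw [lt_div_iff₀ hD] at hs; linarith
    calc C * (C * M * w) * s = (C * (C * M) * s) * w := by ring
      _ ≤ ε * w := by gcongr; nlinarith
  refine HasKurzweilIntegral.of_primitive (F := x) (W := Z.W) ?_ ?_
  · intro ε hε τ hτ
    obtain ⟨δ, hδ, h⟩ := Z.exists_right τ (show 0 < ε / D by positivity)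
    refine ⟨δ, hδ, fun v hv hτv hv' => ?_⟩
    rcases hτv.eq_or_lt with rfl | hlt
    · simp
    have hs := h v hlt hv'
    have h1 := Z.W_le_Wr τ
    have h2 := Z.Wr_le_W hlt
    have hint := herrint τ v τ hτ.1 hτv hv.2
    have hmem := mem_uIcc_of_le h1 h2
    have hint1 := hint.mono_set (uIcc_subset_uIcc_left hmem)
    have hint2 := hint.mono_set (uIcc_subset_uIcc_right hmem)
    -- On the jump interval `T r = τ`, so the integrand vanishes and only the part beyond `Z.Wr τ`
    -- counts.
    rw [herr τ v τ hτ.1 hτv hv.2, ← intervalIntegral.integral_add_adjacent_intervals hint1 hint2,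
      intervalIntegral.integral_congr_Ioo_of_le (g := fun _ => 0) h1
        (fun r hr => by simp [Z.T_eq_of_lt_Wr hr.1.le hr.2])]
    simp only [intervalIntegral.integral_zero, zero_add]
    have h3 : ‖∫ r in Z.Wr τ..Z.W v, deriv Z.B r * (x (Z.T r) - x τ)‖ ≤
        C * (C * M * (Z.W v - Z.W τ)) * |Z.W v - Z.Wr τ| :=
      intervalIntegral.norm_integral_le_of_norm_le_const fun r hr => by
        rw [uIoc_of_le h2] at hr
        have hT := Z.T_mem (u := τ) (v := v) ⟨h1.trans hr.1.le, hr.2⟩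
        refine (norm_mul_le _ _).trans (mul_le_mul (norm_deriv_le r) ?_ (norm_nonneg _) hC0)
        refine (hdiff τ _ hτ.1 hT.1 (hT.2.trans hv.2)).trans ?_
        have := Z.monotone hT.2
        gcongr
    rw [abs_of_nonneg (sub_nonneg.2 h2)] at h3
    exact h3.trans (fin ε _ _ hε (by linarith) (by linarith) hs)
  · intro ε hε τ hτ
    obtain ⟨δ, hδ, h⟩ := Z.exists_left τ (show 0 < ε / D by positivity)
    refine ⟨δ, hδ, fun u hu huτ hu' => ?_⟩
    rcases huτ.eq_or_lt with rfl | hlt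
    · simp
    have hs := h u hlt hu'
    have h1 := Z.W_le_Wl hlt
    have h2 := Z.Wl_le_W τ
    have hint := herrint u τ τ hu.1 huτ hτ.2
    have hmem := mem_uIcc_of_le h1 h2
    have hint1 := hint.mono_set (uIcc_subset_uIcc_left hmem)
    have hint2 := hint.mono_set (uIcc_subset_uIcc_right hmem)
    rw [herr u τ τ hu.1 huτ hτ.2, ← intervalIntegral.integral_add_adjacent_intervals hint1 hint2,
      intervalIntegral.integral_congr_Ioo_of_le (a := Z.Wl τ) (g := fun _ => 0) h2
        (fun r hr => by simp [Z.T_eq_of_Wl_le hr.1.le hr.2])]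
    simp only [intervalIntegral.integral_zero, add_zero]
    have h3 : ‖∫ r in Z.W u..Z.Wl τ, deriv Z.B r * (x (Z.T r) - x τ)‖ ≤
        C * (C * M * (Z.W τ - Z.W u)) * |Z.Wl τ - Z.W u| :=
      intervalIntegral.norm_integral_le_of_norm_le_const fun r hr => by
        rw [uIoc_of_le h1] at hr
        have hT := Z.T_mem (u := u) (v := τ) ⟨hr.1.le, hr.2.trans h2⟩
        refine (norm_mul_le _ _).trans (mul_le_mul (norm_deriv_le r) ?_ (norm_nonneg _) hC0)
        rw [norm_sub_rev]
        refine (hdiff _ τ (hu.1.trans hT.1) hT.2 hτ.2).trans ?_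
        have := Z.monotone hT.1
        gcongr
    rw [abs_of_nonneg (sub_nonneg.2 h1)] at h3
    exact h3.trans (fin ε _ _ hε (by linarith) (by linarith) hs)

end TimeChange

/-! ### Uniqueness of Kurzweil solutions in both directions of time. -/

section Uniqueness

open KurzweilPartition

/-- Iterated halving sends the initial bound to zero; this plays the role of Gronwall's inequality.
-/
theorem eq_zero_of_norm_le_half {α E : Type*} [NormedAddCommGroup E] {x : α → E} {S : Set α}
    {M : ℝ} (hM : ∀ t ∈ S, ‖x t‖ ≤ M)
    (h : ∀ M, (∀ t ∈ S, ‖x t‖ ≤ M) → ∀ t ∈ S, ‖x t‖ ≤ M / 2) : ∀ t ∈ S, x t = 0 := by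
  have hn : ∀ n : ℕ, ∀ t ∈ S, ‖x t‖ ≤ M * (1 / 2) ^ n := by
    intro n
    induction n with
    | zero => simpa using hM
    | succ n ih =>
      intro t ht
      refine (h _ ih t ht).trans_eq ?_
      ring
  intro t ht
  rw [← norm_le_zero_iff]
  have hlim : Tendsto (fun n : ℕ => M * (1 / 2 : ℝ) ^ n) atTop (𝓝 0) := by
    simpa using (tendsto_pow_atTop_nhds_zero_of_lt_one (r := (1 / 2 : ℝ)) (by norm_num)
      (by norm_num)).const_mul M
  exact ge_of_tendsto' hlim fun n => hn n t ht

variable {E : Type*} [NormedAddCommGroup E] [NormedSpace ℝ E] {A : ℝ → E →L[ℝ] E} {a b : ℝ}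
  {x y : ℝ → E}

theorem IsUnit.clm_apply_eq_zero {L : E →L[ℝ] E} (hL : IsUnit L) {z : E} (h : L z = 0) : z = 0 := by
  obtain ⟨J, hJ⟩ := hL.exists_left_inv
  have : J (L z) = z := by rw [← mul_apply_eq_comp, hJ]; rfl
  rw [← this, h, map_zero]

theorem TimeChange.mul_le_half (Z : TimeChange A) {M s : ℝ} (hM : 0 ≤ M)
    (hs : s ≤ 1 / (2 * (Z.C + 1) : ℝ)) : M * (Z.C * s) ≤ M / 2 := by
  have hC : (0 : ℝ) ≤ Z.C := Z.C.2
  have : Z.C * s ≤ 1 / 2 := by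
    calc Z.C * s ≤ Z.C * (1 / (2 * (Z.C + 1))) := by gcongr
      _ ≤ (Z.C + 1) * (1 / (2 * (Z.C + 1))) := by gcongr; linarith
      _ = 1 / 2 := by field_simp
  nlinarith

namespace IsGLDESolution

theorem sub {J : Set ℝ} (hx : IsGLDESolution A J x) (hy : IsGLDESolution A J y) :
    IsGLDESolution A J fun t => x t - y t := by
  intro c d hcd hJ
  have h := (hx c d hcd hJ).sub (hy c d hcd hJ)
  rw [sub_sub_sub_comm] at h
  exact h.congr fun τ _ t _ => (map_sub (A t) _ _).symm

theorem mono {J J' : Set ℝ} (hx : IsGLDESolution A J x) (h : J' ⊆ J) : IsGLDESolution A J' x :=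
  fun c d hcd hJ => hx c d hcd (hJ.trans h)

/-- A solution satisfies the jump condition on the right. -/
theorem tendsto_right (hx : IsGLDESolution A (Icc a b) x) {τ : ℝ} (hτ : τ ∈ Ico a b)
    {L : E →L[ℝ] E} (hL : Tendsto A (𝓝[>] τ) (𝓝 L)) :
    Tendsto x (𝓝[>] τ) (𝓝 ((1 + (L - A τ)) (x τ))) := by
  have h1 : Tendsto (fun v => x v - x τ - (A v - A τ) (x τ)) (𝓝[>] τ) (𝓝 0) := by
    rw [Metric.tendsto_nhds]
    intro ε hε
    obtain ⟨δ, hδ, h⟩ := hx τ b hτ.2.le (Icc_subset_Icc_left hτ.1) (ε / 2) (half_pos hε)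
    have hpos := hδ τ (left_mem_Icc.2 hτ.2.le)
    filter_upwards [Ioo_mem_nhdsGT hτ.2, Ioo_mem_nhdsGT (show τ < τ + δ τ by linarith)]
      with v hv hv'
    -- A nearly exact fine partition of `[v, b]`, preceded by the single interval `[τ, v]` tagged at
    -- `τ`, isolates the error of that one interval.
    obtain ⟨Q, hQ, hQ'⟩ := (hx v b hv.2.le
      (Icc_subset_Icc_left (hτ.1.trans hv.1.le))).exists_partition
      hv.2.le (fun t ht => hδ t ⟨hv.1.le.trans ht.1, ht.2⟩) (half_pos hε)
    have h2 := h _ ((isFine_single hv.1 (left_mem_Icc.2 hv.1.le) (by linarith) hv'.2).append hQ)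
    rw [riemannSum_append, riemannSum_single] at h2
    rw [dist_zero_right]
    calc ‖x v - x τ - (A v - A τ) (x τ)‖
        = ‖(Q.riemannSum (fun τ t => A t (x τ)) - (x b - x v)) -
          ((A v) (x τ) - (A τ) (x τ) + Q.riemannSum (fun τ t => A t (x τ)) - (x b - x τ))‖ := by
          rw [sub_apply]; congr 1; abel
      _ ≤ _ := norm_sub_le _ _
      _ < ε := by linarith
  have h2 : Tendsto (fun v => (A v - A τ) (x τ)) (𝓝[>] τ) (𝓝 ((L - A τ) (x τ))) :=
    ((ContinuousLinearMap.apply ℝ E (x τ)).continuous.tendsto _).comp (hL.sub_const _)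
  have h3 := (h1.add h2).add_const (x τ)
  convert! h3 using 2
  · abel
  · simp [add_comm]

/-- A solution satisfies the jump condition on the left. -/
theorem tendsto_left (hx : IsGLDESolution A (Icc a b) x) {τ : ℝ} (hτ : τ ∈ Ioc a b)
    {L : E →L[ℝ] E} (hL : Tendsto A (𝓝[<] τ) (𝓝 L)) :
    Tendsto x (𝓝[<] τ) (𝓝 ((1 - (A τ - L)) (x τ))) := by
  have h1 : Tendsto (fun u => x τ - x u - (A τ - A u) (x τ)) (𝓝[<] τ) (𝓝 0) := by
    rw [Metric.tendsto_nhds]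
    intro ε hε
    obtain ⟨δ, hδ, h⟩ := hx a τ hτ.1.le (Icc_subset_Icc_right hτ.2) (ε / 2) (half_pos hε)
    have hpos := hδ τ (right_mem_Icc.2 hτ.1.le)
    filter_upwards [Ioo_mem_nhdsLT hτ.1, Ioo_mem_nhdsLT (show τ - δ τ < τ by linarith)]
      with u hu hu'
    obtain ⟨Q, hQ, hQ'⟩ := (hx a u hu.1.le
      (Icc_subset_Icc_right (hu.2.le.trans hτ.2))).exists_partition
      hu.1.le (fun t ht => hδ t ⟨ht.1, ht.2.trans hu.2.le⟩) (half_pos hε)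
    have h2 := h _ (hQ.append (isFine_single hu.2 (right_mem_Icc.2 hu.2.le) hu'.1 (by linarith)))
    rw [riemannSum_append, riemannSum_single] at h2
    rw [dist_zero_right]
    calc ‖x τ - x u - (A τ - A u) (x τ)‖
        = ‖(Q.riemannSum (fun τ t => A t (x τ)) - (x u - x a)) -
          (Q.riemannSum (fun τ t => A t (x τ)) + ((A τ) (x τ) - (A u) (x τ)) - (x τ - x a))‖ := by
          rw [sub_apply]; congr 1; abel
      _ ≤ _ := norm_sub_le _ _
      _ < ε := by linarith
  have h2 : Tendsto (fun u => (A τ - A u) (x τ)) (𝓝[<] τ) (𝓝 ((A τ - L) (x τ))) :=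
    ((ContinuousLinearMap.apply ℝ E (x τ)).continuous.tendsto _).comp (hL.const_sub _)
  have h3 := ((h1.add h2).neg).add_const (x τ)
  convert! h3 using 2
  · abel
  · simp [sub_eq_neg_add]

theorem norm_sub_le (Z : TimeChange A) (hx : IsGLDESolution A (Icc a b) x) (ha : 0 ≤ a)
    {c d M : ℝ} (hac : a ≤ c) (hcd : c ≤ d) (hdb : d ≤ b) (hM : ∀ t ∈ Icc c d, ‖x t‖ ≤ M) :
    ‖x d - x c‖ ≤ M * (Z.C * (Z.W d - Z.W c)) := by
  have h := (hx c d hcd (Icc_subset_Icc hac hdb)).norm_le (W := fun t => M * (Z.C * Z.W t)) hcd ?_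
  · simpa only [mul_sub] using h
  intro u v τ hcu huv hvd hτ
  have hM' := hM τ ⟨hcu.trans hτ.1, hτ.2.trans hvd⟩
  rw [← sub_apply, Z.eq v (by linarith), Z.eq u (by linarith)]
  calc _ ≤ ‖Z.B (Z.W v) - Z.B (Z.W u)‖ * ‖x τ‖ := ContinuousLinearMap.le_opNorm _ _
    _ ≤ (Z.C * (Z.W v - Z.W u)) * M := mul_le_mul (Z.norm_sub_le (Z.monotone huv)) hM'
        (norm_nonneg _) (mul_nonneg Z.C.2 (sub_nonneg.2 (Z.monotone huv)))
    _ = _ := by ring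

/-- The right limit bounds `x` just after `τ`, where increments are at most half of any bound. If `x
τ = 0`, the right limit is zero and halving forces `x v = 0`. If `x v = 0`, halving gives zero on
`(τ, v]`, and invertibility of `1 + Δ⁺A(τ)` carries this back to `τ`. -/
theorem eq_zero_iff_right (Z : TimeChange A) (hx : IsGLDESolution A (Icc a b) x) (ha : 0 ≤ a)
    (hD : ConditionD A) {τ : ℝ} (hτ : τ ∈ Ico a b) :
    ∃ ε > 0, ∀ v ∈ Icc a b, τ < v → v < τ + ε → (x τ = 0 ↔ x v = 0) := by
  have hτ0 : 0 ≤ τ := ha.trans hτ.1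
  have hlim := hx.tendsto_right hτ (Z.tendsto_right hτ0)
  have hunit : IsUnit (1 + (Z.B (Z.Wr τ) - A τ)) := Z.rightLim_eq hτ0 ▸ hD.2 τ hτ0
  obtain ⟨w, hw, hbd⟩ := mem_nhdsGT_iff_exists_Ioo_subset.1
    (hlim.norm.eventually_lt_const (lt_add_one _))
  obtain ⟨δ, hδ, hsmall⟩ := Z.exists_right τ (show 0 < 1 / (2 * (Z.C + 1) : ℝ) by positivity)
  refine ⟨min (w - τ) δ, lt_min (sub_pos.2 hw) hδ, fun v hv hτv hv' => ?_⟩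
  have hvw : v < w := by linarith [min_le_left (w - τ) δ]
  have hvs := hsmall v hτv (by linarith [min_le_right (w - τ) δ])
  have hinc : ∀ M, (∀ t ∈ Ioc τ v, ‖x t‖ ≤ M) → ∀ s t, τ < s → s ≤ t → t ≤ v →
      ‖x t - x s‖ ≤ M / 2 := by
    intro M hM s t hs hst htv
    refine (norm_sub_le Z hx ha (hτ.1.trans hs.le) hst (htv.trans hv.2) fun r hr =>
      hM r ⟨hs.trans_le hr.1, hr.2.trans htv⟩).trans (Z.mul_le_half ?_ ?_)
    · exact (norm_nonneg _).trans (hM v ⟨hτv, le_rfl⟩)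
    · linarith [Z.Wr_le_W hs, Z.monotone htv]
  have hmain : (∀ M, (∀ t ∈ Ioc τ v, ‖x t‖ ≤ M) → ∀ t ∈ Ioc τ v, ‖x t‖ ≤ M / 2) →
      ∀ t ∈ Ioc τ v, x t = 0 :=
    eq_zero_of_norm_le_half fun t ht => le_of_lt (hbd ⟨ht.1, ht.2.trans_lt hvw⟩)
  constructor
  · intro h0
    rw [h0, map_zero] at hlim
    refine hmain (fun M hM t ht => ?_) v ⟨hτv, le_rfl⟩
    have h1 : Tendsto (fun s => ‖x t - x s‖) (𝓝[>] τ) (𝓝 ‖x t - 0‖) := (hlim.const_sub _).norm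
    rw [sub_zero] at h1
    refine le_of_tendsto h1 ?_
    filter_upwards [Ioo_mem_nhdsGT ht.1] with s hs using hinc M hM s t hs.1 hs.2.le ht.2
  · intro h0
    have hz := hmain fun M hM t ht => by
      have := hinc M hM t v ht.1 ht.2 le_rfl
      rwa [h0, zero_sub, norm_neg] at this
    have hlim0 : Tendsto x (𝓝[>] τ) (𝓝 0) := by
      refine tendsto_const_nhds.congr' ?_
      filter_upwards [Ioo_mem_nhdsGT hτv] with s hs using (hz s ⟨hs.1, hs.2.le⟩).symm
    exact hunit.clm_apply_eq_zero (tendsto_nhds_unique hlim hlim0)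

/-- Mirror image of the right-hand case, except that the jump condition is now inverted when moving
forward in time, through `1 - Δ⁻A(τ)`. -/
theorem eq_zero_iff_left (Z : TimeChange A) (hx : IsGLDESolution A (Icc a b) x) (ha : 0 ≤ a)
    (hD : ConditionD A) {τ : ℝ} (hτ : τ ∈ Ioc a b) :
    ∃ ε > 0, ∀ u ∈ Icc a b, u < τ → τ - ε < u → (x u = 0 ↔ x τ = 0) := by
  have hτ0 : 0 < τ := ha.trans_lt hτ.1
  have hlim := hx.tendsto_left hτ (Z.tendsto_left hτ0)
  have hunit : IsUnit (1 - (A τ - Z.B (Z.Wl τ))) := Z.leftLim_eq hτ0 ▸ hD.1 τ hτ0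
  obtain ⟨w, hw, hbd⟩ := mem_nhdsLT_iff_exists_Ioo_subset.1
    (hlim.norm.eventually_lt_const (lt_add_one _))
  obtain ⟨δ, hδ, hsmall⟩ := Z.exists_left τ (show 0 < 1 / (2 * (Z.C + 1) : ℝ) by positivity)
  refine ⟨min (τ - w) δ, lt_min (sub_pos.2 hw) hδ, fun u hu huτ hu' => ?_⟩
  have hwu : w < u := by linarith [min_le_left (τ - w) δ]
  have hus := hsmall u huτ (by linarith [min_le_right (τ - w) δ])
  have hinc : ∀ M, (∀ t ∈ Ico u τ, ‖x t‖ ≤ M) → ∀ s t, u ≤ s → s ≤ t → t < τ →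
      ‖x t - x s‖ ≤ M / 2 := by
    intro M hM s t hs hst htτ
    refine (norm_sub_le Z hx ha (hu.1.trans hs) hst (htτ.le.trans hτ.2) fun r hr =>
      hM r ⟨hs.trans hr.1, hr.2.trans_lt htτ⟩).trans (Z.mul_le_half ?_ ?_)
    · exact (norm_nonneg _).trans (hM u ⟨le_rfl, huτ⟩)
    · linarith [Z.W_le_Wl htτ, Z.monotone hs]
  have hmain : (∀ M, (∀ t ∈ Ico u τ, ‖x t‖ ≤ M) → ∀ t ∈ Ico u τ, ‖x t‖ ≤ M / 2) →
      ∀ t ∈ Ico u τ, x t = 0 :=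
    eq_zero_of_norm_le_half fun t ht => le_of_lt (hbd ⟨hwu.trans_le ht.1, ht.2⟩)
  constructor
  · intro h0
    have hz := hmain fun M hM t ht => by
      have := hinc M hM u t le_rfl ht.1 ht.2
      rwa [h0, sub_zero] at this
    have hlim0 : Tendsto x (𝓝[<] τ) (𝓝 0) := by
      refine tendsto_const_nhds.congr' ?_
      filter_upwards [Ioo_mem_nhdsLT huτ] with s hs using (hz s ⟨hs.1.le, hs.2⟩).symm
    exact hunit.clm_apply_eq_zero (tendsto_nhds_unique hlim hlim0)
  · intro h0
    rw [h0, map_zero] at hlim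
    refine hmain (fun M hM t ht => ?_) u ⟨le_rfl, huτ⟩
    have h1 : Tendsto (fun s => ‖x s - x t‖) (𝓝[<] τ) (𝓝 ‖0 - x t‖) := (hlim.sub_const _).norm
    rw [zero_sub, norm_neg] at h1
    refine le_of_tendsto h1 ?_
    filter_upwards [Ioo_mem_nhdsLT ht.2] with s hs using hinc M hM t s ht.1 hs.1.le hs.2

/-- A solution vanishes at one endpoint of an interval if and only if it vanishes at the other. -/
theorem eq_zero_iff (Z : TimeChange A) (hx : IsGLDESolution A (Icc a b) x) (ha : 0 ≤ a)
    (hab : a ≤ b) (hD : ConditionD A) : x a = 0 ↔ x b = 0 :=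
  Icc_induction hab (R := fun u v => x u = 0 ↔ x v = 0) (fun _ _ => Iff.rfl)
    (fun _ _ _ _ _ _ _ h1 h2 => h1.trans h2) (fun _ ht => eq_zero_iff_left Z hx ha hD ht)
    (fun _ ht => eq_zero_iff_right Z hx ha hD ht)

/-- Two solutions agree at one endpoint of an interval if and only if they agree at the other. -/
theorem eq_iff (Z : TimeChange A) (hx : IsGLDESolution A (Icc a b) x)
    (hy : IsGLDESolution A (Icc a b) y) (ha : 0 ≤ a) (hab : a ≤ b) (hD : ConditionD A) :
    x a = y a ↔ x b = y b := by
  simpa only [sub_eq_zero] using (hx.sub hy).eq_zero_iff Z ha hab hD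

end IsGLDESolution

end Uniqueness

/-! ### Fundamental solution and transition matrix. -/

section TransitionMatrix

variable {E : Type*} [NormedAddCommGroup E] [NormedSpace ℝ E] {A : ℝ → E →L[ℝ] E}

theorem IsGODESolution.apply {J : Set ℝ} {Y : ℝ → E →L[ℝ] E}
    (h : IsGODESolution (fun y t => A t * y) J Y) (e : E) : IsGLDESolution A J fun t => Y t e :=
  fun c d hcd hJ => (h c d hcd hJ).map (ContinuousLinearMap.apply ℝ E e)

theorem IsGODESolution.mul_const {J : Set ℝ} {Y : ℝ → E →L[ℝ] E}
    (h : IsGODESolution (fun y t => A t * y) J Y) (K : E →L[ℝ] E) :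
    IsGODESolution (fun y t => A t * y) J fun t => Y t * K := by
  intro c d hcd hJ
  have h1 := (h c d hcd hJ).map ((ContinuousLinearMap.mul ℝ (E →L[ℝ] E)).flip K)
  simpa only [ContinuousLinearMap.flip_apply, ContinuousLinearMap.mul_apply', sub_mul,
    mul_assoc] using h1

/-- Operator-valued solutions that agree at one endpoint of an interval agree at the other. -/
theorem IsGODESolution.eq_iff (Z : TimeChange A) (hD : ConditionD A) {a b : ℝ} (ha : 0 ≤ a)
    (hab : a ≤ b) {Y Y' : ℝ → E →L[ℝ] E} (h : IsGODESolution (fun y t => A t * y) (Icc a b) Y)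
    (h' : IsGODESolution (fun y t => A t * y) (Icc a b) Y') : Y a = Y' a ↔ Y b = Y' b := by
  simp only [ContinuousLinearMap.ext_iff]
  exact forall_congr' fun e => (h.apply e).eq_iff Z (h'.apply e) ha hab hD

/-- There is an operator-valued solution on `[0, ∞)` with invertible values. -/
theorem exists_fundamental_solution [FiniteDimensional ℝ E] (Z : TimeChange A)
    (hD : ConditionD A) : ∃ Y : ℝ → E →L[ℝ] E,
      IsGODESolution (fun y t => A t * y) (Ici 0) Y ∧ ∀ t, 0 ≤ t → IsUnit (Y t) := by
  choose! x hx hx0 using fun b (hb : 0 ≤ b) => Z.exists_isSolution_Icc hD.1 hb 1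
  have hsol : ∀ b, 0 ≤ b → IsGODESolution (fun y t => A t * y) (Icc 0 b) (x b) := by
    intro b hb c d hcd hJ
    have hc := hJ (left_mem_Icc.2 hcd)
    have hd := hJ (right_mem_Icc.2 hcd)
    exact ((hx b hb).mono hc.1 hcd hd.2).hasKurzweilIntegral hc.1 hcd
  have hmono : ∀ b t, 0 ≤ t → t ≤ b → IsGODESolution (fun y t => A t * y) (Icc 0 t) (x b) :=
    fun b t h0 htb c d hcd hJ => hsol b (h0.trans htb) c d hcd
      (hJ.trans (Icc_subset_Icc_right htb))
  have hcons : ∀ b t, 0 ≤ t → t ≤ b → x b t = x t t := fun b t h0 htb =>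
    (IsGODESolution.eq_iff Z hD le_rfl h0 (hmono b t h0 htb) (hsol t h0)).1
      (by rw [hx0 b (h0.trans htb), hx0 t h0])
  -- By uniqueness the solutions on the intervals `[0, b]` extend each other, so the diagonal is a
  -- global solution. Backward uniqueness makes its values injective, hence invertible in finite
  -- dimension.
  refine ⟨fun t => x t t, fun c d hcd hJ => ?_, fun t ht => ?_⟩
  · have hc : 0 ≤ c := hJ (left_mem_Icc.2 hcd)
    have hd : 0 ≤ d := hc.trans hcd
    have h := hsol d hd c d hcd (Icc_subset_Icc_left hc)
    rw [hcons d c hc hcd] at h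
    exact h.congr fun τ hτ t _ => by simp only [hcons d τ (hc.trans hτ.1) hτ.2]
  · rw [ContinuousLinearMap.isUnit_iff_bijective]
    have hinj : Function.Injective (x t t) := by
      rw [injective_iff_map_eq_zero]
      intro e he
      have h := ((hsol t ht).apply e).eq_zero_iff Z le_rfl ht hD
      rw [hx0 t ht] at h
      exact h.2 he
    exact ⟨hinj, LinearMap.injective_iff_surjective (f := (x t t : E →ₗ[ℝ] E)).1 hinj⟩

namespace IsTransitionMatrix

variable {U V : ℝ → ℝ → E →L[ℝ] E} {s : ℝ}

theorem self_eq_one (hU : IsTransitionMatrix A U) (hs : 0 ≤ s) : U s s = 1 :=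
  sub_eq_zero.1 ((hU s s hs hs).1 le_rfl).self_eq_zero

theorem isGODESolution_Ici (hU : IsTransitionMatrix A U) (hs : 0 ≤ s) :
    IsGODESolution (fun y t => A t * y) (Ici s) fun t => U t s := by
  intro c d hcd hJ
  have hsc : s ≤ c := hJ (left_mem_Icc.2 hcd)
  have hsd := hsc.trans hcd
  have h := HasKurzweilIntegral.of_left ((hU c s (hs.trans hsc) hs).1 hsc)
    ((hU d s (hs.trans hsd) hs).1 hsd) hsc hcd
  rwa [sub_sub_sub_cancel_right] at h

theorem isGODESolution_Icc (hU : IsTransitionMatrix A U) {a : ℝ} (ha : 0 ≤ a) (has : a ≤ s) :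
    IsGODESolution (fun y t => A t * y) (Icc a s) fun t => U t s := by
  have hs := ha.trans has
  have key : ∀ t, a ≤ t → t ≤ s →
      HasKurzweilIntegral (fun τ r => A r * U τ s) t s (1 - U t s) := by
    intro t hat hts
    have h := hU t s (ha.trans hat) hs
    -- The reversed orientation is defined only for `t < s`; at `t = s` the integral is zero.
    rcases hts.eq_or_lt with rfl | hlt
    · rw [hU.self_eq_one hs, sub_self]
      simpa [hU.self_eq_one hs] using h.1 le_rfl
    · rw [← neg_sub]; exact h.2 hlt
  intro c d hcd hJ
  have hc := hJ (left_mem_Icc.2 hcd)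
  have hd := hJ (right_mem_Icc.2 hcd)
  have h := (key d hd.1 hd.2).of_right (key c hc.1 hc.2) hcd hd.2
  rwa [sub_sub_sub_cancel_left] at h

/-- Uniqueness of the transition matrix. -/
theorem eq (hU : IsTransitionMatrix A U) (hV : IsTransitionMatrix A V) (Z : TimeChange A)
    (hD : ConditionD A) {t : ℝ} (ht : 0 ≤ t) (hs : 0 ≤ s) : V t s = U t s := by
  have h1 : V s s = U s s := by rw [hU.self_eq_one hs, hV.self_eq_one hs]
  rcases le_total s t with h | h
  · refine (IsGODESolution.eq_iff Z hD hs h (Y := fun t => V t s) (Y' := fun t => U t s)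
      ?_ ?_).1 h1
    · exact fun c d hcd hJ => hV.isGODESolution_Ici hs c d hcd (hJ.trans Icc_subset_Ici_self)
    · exact fun c d hcd hJ => hU.isGODESolution_Ici hs c d hcd (hJ.trans Icc_subset_Ici_self)
  · exact (IsGODESolution.eq_iff Z hD ht h (Y := fun t => V t s) (Y' := fun t => U t s)
      (hV.isGODESolution_Icc ht h) (hU.isGODESolution_Icc ht h)).2 h1

theorem isGLDESolution (hU : IsTransitionMatrix A U) (hs : 0 ≤ s) (e : E) :
    IsGLDESolution A (Ici s) fun t => U t s e := (hU.isGODESolution_Ici hs).apply e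

/-- Solutions are represented by the transition matrix. -/
theorem solution_eq (hU : IsTransitionMatrix A U) (Z : TimeChange A) (hD : ConditionD A)
    (hs : 0 ≤ s) {x : ℝ → E} (hx : IsGLDESolution A (Ici s) x) {t : ℝ} (hst : s ≤ t) :
    x t = U t s (x s) :=
  ((hx.mono Icc_subset_Ici_self).eq_iff Z
    ((hU.isGLDESolution hs (x s)).mono Icc_subset_Ici_self) hs hst hD).1
    (by simp [hU.self_eq_one hs])

theorem mul_eq (hU : IsTransitionMatrix A U) (Z : TimeChange A) (hD : ConditionD A)
    (hs : 0 ≤ s) {r t : ℝ} (hsr : s ≤ r) (hrt : r ≤ t) : U t s = U t r * U r s := by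
  ext e
  exact hU.solution_eq Z hD (hs.trans hsr)
    ((hU.isGLDESolution hs e).mono (Ici_subset_Ici.2 hsr)) hrt

end IsTransitionMatrix

theorem exists_isTransitionMatrix [FiniteDimensional ℝ E] (Z : TimeChange A)
    (hD : ConditionD A) : ∃ U, IsTransitionMatrix A U := by
  obtain ⟨Y, hY, hunit⟩ := exists_fundamental_solution Z hD
  refine ⟨fun t s => Y t * Ring.inverse (Y s), fun t s ht hs => ?_⟩
  have h1 : Y s * Ring.inverse (Y s) = 1 := Ring.mul_inverse_cancel _ (hunit s hs)
  have h := hY.mul_const (Ring.inverse (Y s))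
  refine ⟨fun hst => ?_, fun hts => ?_⟩
  · have := h s t hst (Icc_subset_Ici_self.trans (Ici_subset_Ici.2 hs))
    beta_reduce at this ⊢
    rwa [h1] at this
  · have := h t s hts.le (Icc_subset_Ici_self.trans (Ici_subset_Ici.2 ht))
    beta_reduce at this ⊢
    rwa [h1, ← neg_sub] at this

end TransitionMatrix

/-! ### Equivalence of the stability notions. -/

section Stability

variable {E : Type*} [NormedAddCommGroup E] [NormedSpace ℝ E] {A : ℝ → E →L[ℝ] E}
  {U : ℝ → ℝ → E →L[ℝ] E}

theorem ContinuousLinearMap.opNorm_le_of_forall_norm_lt {L : E →L[ℝ] E} {δ ε : ℝ} (hδ : 0 < δ)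
    (hε : 0 ≤ ε) (h : ∀ e, ‖e‖ < δ → ‖L e‖ ≤ ε) : ‖L‖ ≤ 2 * ε / δ := by
  refine L.opNorm_le_bound (by positivity) fun e => ?_
  rcases eq_or_ne e 0 with rfl | he
  · simp
  have hn : 0 < ‖e‖ := norm_pos_iff.2 he
  -- The open ball excludes norm `δ`, so `e` is rescaled to norm `δ / 2`; this costs the factor 2.
  have h1 := h ((δ / (2 * ‖e‖)) • e) (by
    rw [norm_smul, Real.norm_of_nonneg (by positivity)]
    have : δ / (2 * ‖e‖) * ‖e‖ = δ / 2 := by field_simp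
    linarith)
  rw [map_smul, norm_smul, Real.norm_of_nonneg (by positivity)] at h1
  calc ‖L e‖ = (δ / (2 * ‖e‖) * ‖L e‖) * (2 * ‖e‖ / δ) := by field_simp
    _ ≤ ε * (2 * ‖e‖ / δ) := by gcongr
    _ = 2 * ε / δ * ‖e‖ := by ring

theorem UniformlyAsymptoticallyStable.exists_exp_bound (Z : TimeChange A) (hD : ConditionD A)
    (hU : IsTransitionMatrix A U) (h : UniformlyAsymptoticallyStable A) :
    ∃ α > 0, ∃ K > 0, ∀ t s : ℝ, 0 ≤ s → s ≤ t → ‖U t s‖ ≤ K * Real.exp (-α * (t - s)) := by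
  obtain ⟨hstab, δ₀, hδ₀, hattr⟩ := h
  obtain ⟨δ, hδ, hstab⟩ := hstab 1 one_pos
  -- With that factor 2, the tolerance `δ₀ / 4` yields operator norm at most `1 / 2`.
  obtain ⟨T₀, hT₀, hattr⟩ := hattr (δ₀ / 4) (by positivity)
  set M : ℝ := 2 * 1 / δ with hM
  have hM0 : 0 < M := by positivity
  have hself : ∀ s, 0 ≤ s → ∀ e, U s s e = e := fun s hs e => by rw [hU.self_eq_one hs]; rfl
  have b1 : ∀ t s, 0 ≤ s → s ≤ t → ‖U t s‖ ≤ M := fun t s hs hst =>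
    ContinuousLinearMap.opNorm_le_of_forall_norm_lt hδ zero_le_one fun e he =>
      (hstab s hs _ (hU.isGLDESolution hs e) (by simpa only [hself s hs] using he) t hst).le
  set T : ℝ := T₀ + 1 with hT
  have hTpos : 0 < T := by linarith
  have b2 : ∀ s, 0 ≤ s → ‖U (s + T) s‖ ≤ 1 / 2 := fun s hs => by
    have h1 := ContinuousLinearMap.opNorm_le_of_forall_norm_lt (L := U (s + T) s) hδ₀
      (show 0 ≤ δ₀ / 4 by positivity) fun e he =>
      (hattr s hs _ (hU.isGLDESolution hs e) (by simpa only [hself s hs] using he) (s + T)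
        (by linarith)).le
    refine h1.trans_eq ?_
    field_simp
    norm_num
  have b3 : ∀ n : ℕ, ∀ t s, 0 ≤ s → s + n * T ≤ t → ‖U t s‖ ≤ M * (1 / 2) ^ n := by
    intro n
    induction n with
    | zero => intro t s hs hst; simpa using b1 t s hs (by simpa using hst)
    | succ n ih =>
      intro t s hs hst
      push_cast at hst
      have hnT : 0 ≤ n * T := by positivity
      rw [hU.mul_eq Z hD hs (show s ≤ s + T by linarith) (by linarith)]
      calc _ ≤ ‖U t (s + T)‖ * ‖U (s + T) s‖ := norm_mul_le _ _
        _ ≤ (M * (1 / 2) ^ n) * (1 / 2) := mul_le_mul (ih t (s + T) (by linarith) (by linarith))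
            (b2 s hs) (norm_nonneg _) (by positivity)
        _ = _ := by ring
  have hlog : 0 < Real.log 2 := Real.log_pos one_lt_two
  -- This rate turns one halving per period `T` into an exponential; the factor 2 pays for rounding
  -- `(t - s) / T` down.
  refine ⟨Real.log 2 / T, by positivity, 2 * M, by positivity, fun t s hs hst => ?_⟩
  have hq : 0 ≤ (t - s) / T := div_nonneg (by linarith) hTpos.le
  set n := ⌊(t - s) / T⌋₊ with hn
  have h1 : n * T ≤ t - s := (le_div_iff₀ hTpos).1 (Nat.floor_le hq)
  have h2 : (t - s) / T < n + 1 := Nat.lt_floor_add_one _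
  have h3 : (1 / 2 : ℝ) ^ (n + 1) ≤ Real.exp (-(Real.log 2 / T) * (t - s)) := by
    have : (1 / 2 : ℝ) = Real.exp (-Real.log 2) := by
      rw [Real.exp_neg, Real.exp_log two_pos]; norm_num
    rw [this, ← Real.exp_nat_mul, Real.exp_le_exp]
    push_cast
    have : Real.log 2 / T * (t - s) = Real.log 2 * ((t - s) / T) := by ring
    nlinarith
  calc ‖U t s‖ ≤ M * (1 / 2) ^ n := b3 n t s hs (by linarith)
    _ = 2 * M * (1 / 2) ^ (n + 1) := by ring
    _ ≤ _ := by gcongr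

theorem IsTransitionMatrix.globallyUniformlyExponentiallyStable (hU : IsTransitionMatrix A U)
    (Z : TimeChange A) (hD : ConditionD A)
    (h : ∃ α > 0, ∃ K > 0, ∀ t s : ℝ, 0 ≤ s → s ≤ t → ‖U t s‖ ≤ K * Real.exp (-α * (t - s))) :
    GloballyUniformlyExponentiallyStable A := by
  obtain ⟨α, hα, K, hK, h⟩ := h
  -- Enlarging `K` makes the inequality strict, since `x s ≠ 0`.
  refine ⟨α, hα, K + 1, by positivity, fun s hs x hx hx0 t hst => ?_⟩
  have hn : 0 < ‖x s‖ := norm_pos_iff.2 hx0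
  rw [hU.solution_eq Z hD hs hx hst]
  calc ‖U t s (x s)‖ ≤ ‖U t s‖ * ‖x s‖ := ContinuousLinearMap.le_opNorm _ _
    _ ≤ K * Real.exp (-α * (t - s)) * ‖x s‖ := by gcongr; exact h t s hs hst
    _ = K * ‖x s‖ * Real.exp (-α * (t - s)) := by ring
    _ < (K + 1) * ‖x s‖ * Real.exp (-α * (t - s)) := by gcongr; linarith

theorem GloballyUniformlyExponentiallyStable.uniformlyAsymptoticallyStable (Z : TimeChange A)
    (hD : ConditionD A) (h : GloballyUniformlyExponentiallyStable A) :
    UniformlyAsymptoticallyStable A := by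
  obtain ⟨α, hα, K, hK, h⟩ := h
  have hle : ∀ s, 0 ≤ s → ∀ x, IsGLDESolution A (Ici s) x → ∀ t, s ≤ t →
      ‖x t‖ ≤ K * ‖x s‖ * Real.exp (-α * (t - s)) := by
    intro s hs x hx t hst
    -- Exponential stability says nothing about a zero initial value; uniqueness covers it.
    by_cases h0 : x s = 0
    · rw [((hx.mono Icc_subset_Ici_self).eq_zero_iff Z hs hst hD).1 h0, h0]
      simp
    · exact (h s hs x hx h0 t hst).le
  -- The time solves `K * exp (-α * T) = ε`; the maximum with 0 covers `K < ε`.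
  refine ⟨fun ε hε => ⟨ε / K, by positivity, fun s hs x hx hxs t hst => ?_⟩, 1, one_pos,
    fun ε hε => ⟨max 0 (Real.log (K / ε) / α), le_max_left _ _, fun s hs x hx hxs t hst => ?_⟩⟩
  · calc ‖x t‖ ≤ K * ‖x s‖ * Real.exp (-α * (t - s)) := hle s hs x hx t hst
      _ ≤ K * ‖x s‖ * 1 := by
        gcongr
        rw [Real.exp_le_one_iff]
        nlinarith
      _ = K * ‖x s‖ := mul_one _
      _ < K * (ε / K) := by gcongr
      _ = ε := by field_simp
  · have h1 := le_max_left 0 (Real.log (K / ε) / α)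
    have h2 : Real.log (K / ε) / α ≤ t - s := by linarith [le_max_right 0 (Real.log (K / ε) / α)]
    have h3 : Real.exp (-α * (t - s)) ≤ ε / K := by
      rw [div_le_iff₀ hα] at h2
      calc Real.exp (-α * (t - s)) ≤ Real.exp (-Real.log (K / ε)) := by
            rw [Real.exp_le_exp]; linarith
        _ = ε / K := by rw [Real.exp_neg, Real.exp_log (by positivity), inv_div]
    calc ‖x t‖ ≤ K * ‖x s‖ * Real.exp (-α * (t - s)) := hle s hs x hx t (by linarith)
      _ < K * 1 * Real.exp (-α * (t - s)) := by gcongr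
      _ ≤ K * 1 * (ε / K) := by gcongr
      _ = ε := by field_simp

end Stability

theorem theorem3p4 {E : Type*} [NormedAddCommGroup E] [NormedSpace ℝ E] [FiniteDimensional ℝ E]
    (A : ℝ → E →L[ℝ] E) (hA : LocallyBoundedVariationOn A (Set.Ici 0)) (hD : ConditionD A) :
    ∃ U : ℝ → ℝ → E →L[ℝ] E,
      -- `U` is the transition matrix, and it is uniquely determined on `[0,∞) × [0,∞)`
      IsTransitionMatrix A U ∧
      (∀ V : ℝ → ℝ → E →L[ℝ] E, IsTransitionMatrix A V →
        ∀ t s : ℝ, 0 ≤ t → 0 ≤ s → V t s = U t s) ∧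
      (UniformlyAsymptoticallyStable A ↔
        ∃ α > 0, ∃ K > 0, ∀ t s : ℝ, 0 ≤ s → s ≤ t →
          ‖U t s‖ ≤ K * Real.exp (-α * (t - s))) ∧
      (UniformlyAsymptoticallyStable A ↔ GloballyUniformlyExponentiallyStable A) := by
  obtain ⟨Z⟩ := hA.nonempty_timeChange
  obtain ⟨U, hU⟩ := exists_isTransitionMatrix Z hD
  refine ⟨U, hU, fun V hV t s ht hs => hU.eq hV Z hD ht hs, ⟨fun h => ?_, fun h => ?_⟩,
    ⟨fun h => ?_, fun h => ?_⟩⟩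
  · exact h.exists_exp_bound Z hD hU
  · exact (hU.globallyUniformlyExponentiallyStable Z hD h).uniformlyAsymptoticallyStable Z hD
  · exact hU.globallyUniformlyExponentiallyStable Z hD (h.exists_exp_bound Z hD hU)
  · exact h.uniformlyAsymptoticallyStable Z hD
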